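/- Proposition. Assume $\mathsf{CH}$. Let $l,n\in\omega$ with $l>0$, let $\kappa>\aleph_l$ be a regular cardinal, let $\mathsf{H}(\kappa)$ be the set of all sets whose transitive closure has size less than $\kappa$, and fix a well-order $\trianglelefteq$ of $\mathsf{H}(\kappa)$. Notation. $\mathsf{Sub}(\kappa)$ is the collection of all countable $M\subseteq\mathsf{H}(\kappa)$ such that $(M,\in,\trianglelefteq)$ is an elementary submodel of $(\mathsf{H}(\kappa),\in,\trianglelefteq)$, and $\delta_M=M\cap\omega_1$ (an ordinal) for $M\in\mathsf{Sub}(\kappa)$. A $0$-model is a member of $\mathsf{Sub}(\kappa)$; a $(k+1)$-model is an $N\in\mathsf{Sub}(\kappa)$ for which there are $k$-models $N_\alpha\in N$ $(\alpha<\delta_N)$ with $N_\alpha\in N_\beta$ whenever $\alpha<\beta<\delta_N$, $N_\alpha=\bigcup_{\xi<\alpha}N_\xi$ for limit $\alpha<\delta_N$, and $N=\bigcup_{\alpha<\delta_N}N_\alpha$. A finite sequence $\langle M_0,\dots,M_m\rangle$ of members of $\mathsf{Sub}(\kappa)$ is $\delta$-increasing if $\delta_{M_i}\le\delta_{M_{i+1}}$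 for all $i<m$. A partition is a collection of pairwise disjoint sets ($\emptyset$ is allowed as an element). A decisive partition for a $\delta$-increasing $\langle M_0,\dots,M_m\rangle$ is a sequence $P=\langle P_i\mid i\le m\rangle$ such that each $P_i\in M_i$ is a finite partition consisting of countable subsets of $\omega_l$, and, whenever $i<j\le m$ and $A\in P_i$, either $A\in P_j$ or $A\cap M_j=\emptyset$. For partitions $R,P$, $R$ refines $P$ if every element of $R$ is contained in an element of $P$ and every element of $P$ is a union of elements of $R$. Statement. Let $\langle M_0,\dots,M_n\rangle$ be $\delta$-increasing and let $P=\langle P_i\mid i\le n\rangle$ be a decisive partition for it. Let $N$ be an $l$-model with $\delta_{M_n}<\delta_N$, let $D\in N$ be a countable subset of $\omega_l$, and let $X\in N$ be any set. Then there are $L\in N$ and $R=\langle R_i\mid i\le n+1\rangle$ such that 1. $L\in\mathsf{Sub}(\kappa)$, $\delta_{M_n}<\delta_L$ and $X,D\in L$; 2. $R$ is a decisive partition for $\langle M_0,\dots,M_n,L\rangle$; 3. $R_i$ refines $P_i$ for every $i\le n$; 4. $D\subseteq\bigcup R_{n+1}$. -/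

import Mathlib

universe u

namespace CountableModels

open scoped ZFSet

/-- The transitive closure of `x`: the set of all `y` with `y ∈ y₁ ∈ ⋯ ∈ x`. -/
noncomputable def trcl (x : ZFSet.{u}) : ZFSet.{u} :=
  ZFSet.sep (fun y => Relation.TransGen (fun a b : ZFSet.{u} => a ∈ b) y x) (V_ (ZFSet.rank x))

/-- The bounding set in `trcl` loses nothing. -/
theorem mem_trcl {x y : ZFSet.{u}} :
    y ∈ trcl x ↔ Relation.TransGen (fun a b : ZFSet.{u} => a ∈ b) y x := by
  unfold trcl
  rw [ZFSet.mem_sep, and_iff_right_iff_imp]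
  intro h
  rw [ZFSet.mem_vonNeumann]
  induction h with
  | single h => exact ZFSet.rank_lt_of_mem h
  | tail _ h ih => exact ih.trans (ZFSet.rank_lt_of_mem h)

/-- `H(κ)`: the sets whose transitive closure has size less than `κ`. -/
def H (κ : Cardinal.{u}) : Set ZFSet.{u} := {x | (trcl x).card < κ}

/-- The two binary relation symbols `∈` and `⊴`. -/
inductive SetRel : ℕ → Type
  | mem : SetRel 2
  | wo : SetRel 2

/-- The first-order language with the relation symbols `∈` and `⊴`. -/
def setLanguage : FirstOrder.Language.{0, 0} := ⟨fun _ => Empty, SetRel⟩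

/-- The structure `(H(κ), ∈, ⊴)`. The symbol `⊴` is read as the given (strict) well-order. -/
@[reducible]
def hStructure (κ : Cardinal.{u}) (wo : H κ → H κ → Prop) : setLanguage.Structure (H κ) where
  funMap := fun f _ => nomatch f
  RelMap := fun {_} r => match r with
    | SetRel.mem => fun v => (v 0 : ZFSet.{u}) ∈ (v 1 : ZFSet.{u})
    | SetRel.wo => fun v => wo (v 0) (v 1)

/-- `M ∈ Sub(κ)`: `M` is a countable subset of `H(κ)` and `(M, ∈, ⊴)` is an elementary submodel
of `(H(κ), ∈, ⊴)`. -/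
structure IsSub (κ : Cardinal.{u}) (wo : H κ → H κ → Prop) (M : ZFSet.{u}) : Prop where
  subset : ∀ x ∈ M, x ∈ H κ
  countable : (M : Set ZFSet.{u}).Countable
  elementary : letI := hStructure κ wo
    ∃ S : setLanguage.ElementarySubstructure (H κ), ∀ x : H κ, x ∈ S ↔ (x : ZFSet.{u}) ∈ M

/-- The von Neumann ordinal `ω_l` as a set. -/
noncomputable def omegaSet (l : ℕ) : ZFSet.{u} := (Ordinal.omega (l : Ordinal.{u})).toZFSet

/-- The height `δ_M = M ∩ ω₁`. The heights of members of `Sub(κ)` are (von Neumann) ordinals, so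
`δ_M ≤ δ_N` means `height M ⊆ height N` and `δ_M < δ_N` means `height M ∈ height N`. -/
noncomputable def height (M : ZFSet.{u}) : ZFSet.{u} := M ∩ omegaSet 1

/-- `k`-models. For `k + 1` the chain `C` is indexed by the ordinals `α < δ_N`; its values at
other ordinals are irrelevant. -/
def IsModel (κ : Cardinal.{u}) (wo : H κ → H κ → Prop) : ℕ → ZFSet.{u} → Prop
  | 0, N => IsSub κ wo N
  | k + 1, N => IsSub κ wo N ∧ ∃ C : Ordinal.{u} → ZFSet.{u},
      (∀ α : Ordinal.{u}, α.toZFSet ∈ height N → C α ∈ N ∧ IsModel κ wo k (C α)) ∧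
      (∀ α β : Ordinal.{u}, β.toZFSet ∈ height N → α < β → C α ∈ C β) ∧
      (∀ α : Ordinal.{u}, α.toZFSet ∈ height N → Order.IsSuccLimit α →
        ∀ x, x ∈ C α ↔ ∃ ξ < α, x ∈ C ξ) ∧
      (∀ x, x ∈ N ↔ ∃ α : Ordinal.{u}, α.toZFSet ∈ height N ∧ x ∈ C α)

/-- A `δ`-increasing sequence of members of `Sub(κ)`. -/
def IsDeltaIncreasing (κ : Cardinal.{u}) (wo : H κ → H κ → Prop) {m : ℕ}
    (M : Fin m → ZFSet.{u}) : Prop :=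
  (∀ i, IsSub κ wo (M i)) ∧ ∀ i j, i ≤ j → height (M i) ⊆ height (M j)

/-- A partition: a collection of pairwise disjoint sets, the empty set being allowed. -/
def IsPartition (P : ZFSet.{u}) : Prop :=
  ∀ A ∈ P, ∀ B ∈ P, A ≠ B → A ∩ B = ∅

/-- `A ∈ [ω_l]^{≤ω}`. -/
def IsCountableSubset (l : ℕ) (A : ZFSet.{u}) : Prop :=
  A ⊆ omegaSet l ∧ (A : Set ZFSet.{u}).Countable

/-- `P` is a decisive partition (of countable subsets of `ω_l`) for the sequence `M`. -/
structure IsDecisive (l : ℕ) {m : ℕ} (M P : Fin m → ZFSet.{u}) : Prop where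
  mem : ∀ i, P i ∈ M i
  finite : ∀ i, (P i : Set ZFSet.{u}).Finite
  partition : ∀ i, IsPartition (P i)
  countable : ∀ i, ∀ A ∈ P i, IsCountableSubset l A
  decisive : ∀ i j, i < j → ∀ A ∈ P i, A ∈ P j ∨ A ∩ M j = ∅

/-- `R` refines `P`. -/
def Refines (R P : ZFSet.{u}) : Prop :=
  (∀ A ∈ R, ∃ B ∈ P, A ⊆ B) ∧ ∀ B ∈ P, ∃ S : ZFSet.{u}, S ⊆ R ∧ ZFSet.sUnion S = B

end CountableModels

/-!
The sequence `M`, the partitions and `N` are given; the task is to find `L ∈ N` such that the trace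
`A ∩ L` of every `A` in some `P i` lies both in `M i` and in `L`. Once this is known, `R i` is
obtained by cutting every member of `P i` along `L`, and `R (n + 1)` consists of all the traces
together with the part of `D` that they do not cover (`IsDecisive.exists_extension`). Decisiveness
of `P` makes the traces pairwise disjoint: two sets from different `P i` and `P j` that share a
point are equal.

The model `L` comes from `exists_model_inter_mem`, an induction on `k` for `k`-models `N` and
finitely many countable sets `A i ∈ M i` of ordinals below `ω_(k+1)`; for `l = k + 1` it is applied
to a sufficiently late member of the chain of `k`-models whose union is the `l`-model `N`. Suprema
are strict, so that `sup S` is the least ordinal above all elements of `S`.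

* For `k = 0` one takes `L = N`. By `CH` the power set of a countable ordinal injects into `ω₁`, and
  the `⊴`-least injection belongs to all models that contain the ordinal; hence a countable subset
  of `ω₁` in `M i` is coded by an ordinal below the height of `M i` and belongs to `N`.
* For the step let `C α` be the chain of `k`-models with union `N`, and consider
  `ξ α = sup (A i ∩ C α)`. It always lies in `M i`, because `A i` is countable
  (`IsSub.ordSup_mem_of_countable`), and in `C (α + 1)`, because it is definable from `C α` and an
  element of `C α` (`IsSub.ordSup_inter_mem_of_mem`). If `ξ α = ξ (α + 1)`, this ordinal therefore
  lies in `K = C (α + 1)` and in `M i`, and so does the `⊴`-least injection of it into `ω_(k+1)`.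
  This injection moves `A i ∩ ξ` to a subset of `ω_(k+1)`, to which the induction hypothesis for `K`
  applies, and its inverse moves the resulting trace back.
* An `α` that works for all `i` at once exists by counting: `ξ` grows with `α`, and the order type of
  `A i` is below the height `δ` of `N`. If some `ξ` changed at every step, then coding all the
  order types of the `A i ∩ ξ` by single ordinals below `δ` would give a strictly increasing function
  on `δ` that is bounded below `δ` (`IsPairingClosed.exists_constant_step`).

Elementarity enters only through `exists_canonical`: the `⊴`-least witness of a definable property
belongs to every elementary submodel that contains the parameters. Definability is dealt with by the
class `IsDefinable`, whose instances are the closure properties of definable predicates.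
-/

universe v

namespace CountableModels

open scoped ZFSet
open Cardinal

variable {κ : Cardinal.{u}} {wo : H κ → H κ → Prop}

/-! ### The sets `H(κ)` -/

theorem trcl_subset_trcl_of_mem {x y : ZFSet.{u}} (h : y ∈ x) : trcl y ⊆ trcl x := by
  intro z hz
  rw [mem_trcl] at hz ⊢
  exact hz.tail h

theorem trcl_mono {x y : ZFSet.{u}} (h : y ⊆ x) : trcl y ⊆ trcl x := by
  intro z hz
  rw [mem_trcl] at hz ⊢
  rcases Relation.TransGen.tail'_iff.1 hz with ⟨w, hzw, hw⟩
  exact Relation.TransGen.tail'_iff.2 ⟨w, hzw, h hw⟩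

theorem mem_H_of_mem {x y : ZFSet.{u}} (hx : x ∈ H κ) (h : y ∈ x) : y ∈ H κ :=
  (ZFSet.card_mono (trcl_subset_trcl_of_mem h)).trans_lt hx

theorem mem_H_of_subset {x y : ZFSet.{u}} (hx : x ∈ H κ) (h : y ⊆ x) : y ∈ H κ :=
  (ZFSet.card_mono (trcl_mono h)).trans_lt hx

theorem subset_trcl (x : ZFSet.{u}) : x ⊆ trcl x := fun _ h => mem_trcl.2 (.single h)

theorem range_mem_H (hκ : κ.IsRegular) {ι : Type u} (hι : #ι < κ) {f : ι → ZFSet.{u}}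
    (hf : ∀ i, f i ∈ H κ) : ZFSet.range f ∈ H κ := by
  have hsub : trcl (ZFSet.range f) ⊆ ZFSet.range f ∪ ZFSet.iUnion fun i => trcl (f i) := by
    intro z hz
    rw [mem_trcl] at hz
    rcases Relation.TransGen.tail'_iff.1 hz with ⟨w, hzw, hw⟩
    obtain ⟨i, rfl⟩ := ZFSet.mem_range.1 hw
    rcases Relation.reflTransGen_iff_eq_or_transGen.1 hzw with h | h
    · exact ZFSet.mem_union.2 (.inl (h ▸ hw))
    · exact ZFSet.mem_union.2 (.inr (ZFSet.mem_iUnion.2 ⟨i, mem_trcl.2 h⟩))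
  refine (ZFSet.card_mono hsub).trans_lt (ZFSet.card_union_le.trans_lt ?_)
  refine add_lt_of_lt hκ.aleph0_le ?_ ?_
  · have := ZFSet.lift_card_range_le (f := f)
    rw [lift_id, lift_id] at this
    exact this.trans_lt hι
  · have := ZFSet.lift_card_iUnion_le_sum_card (f := fun i => trcl (f i))
    rw [lift_id] at this
    exact this.trans_lt (sum_lt_of_isRegular hκ hι hf)

theorem mem_H_of_forall_mem (hκ : κ.IsRegular) {s : ZFSet.{u}} (hs : s.card < κ)
    (h : ∀ x ∈ s, x ∈ H κ) : s ∈ H κ := by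
  have : ZFSet.range (fun i : Shrink.{u} s => (((equivShrink s).symm i : s) : ZFSet.{u})) = s := by
    ext z
    rw [ZFSet.mem_range]
    constructor
    · rintro ⟨i, rfl⟩; exact Subtype.prop _
    · intro hz; exact ⟨equivShrink s ⟨z, hz⟩, by simp⟩
  rw [← this]
  exact range_mem_H hκ hs fun i => h _ (Subtype.prop _)

theorem insert_mem_H (hκ : κ.IsRegular) {x s : ZFSet.{u}} (hx : x ∈ H κ) (hs : s ∈ H κ) :
    insert x s ∈ H κ := by
  refine mem_H_of_forall_mem hκ ?_ ?_
  · refine ZFSet.card_insert_le.trans_lt (add_lt_of_lt hκ.aleph0_le ?_ ?_)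
    · exact (ZFSet.card_mono (subset_trcl s)).trans_lt hs
    · exact one_lt_aleph0.trans_le hκ.aleph0_le
  · intro y hy
    rcases ZFSet.mem_insert_iff.1 hy with rfl | hy
    · exact hx
    · exact mem_H_of_mem hs hy

theorem empty_mem_H (hκ : κ.IsRegular) : (∅ : ZFSet.{u}) ∈ H κ :=
  mem_H_of_forall_mem hκ (by simpa using hκ.pos) (by simp)

theorem pair_mem_H (hκ : κ.IsRegular) {x y : ZFSet.{u}} (hx : x ∈ H κ) (hy : y ∈ H κ) :
    ZFSet.pair x y ∈ H κ := by
  have h1 : ∀ {z : ZFSet.{u}}, z ∈ H κ → ({z} : ZFSet.{u}) ∈ H κ := fun hz => by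
    rw [← LawfulSingleton.insert_empty_eq]
    exact insert_mem_H hκ hz (empty_mem_H hκ)
  exact insert_mem_H hκ (h1 hx) (h1 (insert_mem_H hκ hx (h1 hy)))

theorem toZFSet_mem_H (hκ : κ.IsRegular) {o : Ordinal.{u}} (ho : o.card < κ) :
    o.toZFSet ∈ H κ := by
  induction o using WellFoundedLT.induction with
  | ind o ih =>
    refine mem_H_of_forall_mem hκ (by rwa [Ordinal.card_toZFSet]) ?_
    intro x hx
    obtain ⟨a, ha, rfl⟩ := Ordinal.mem_toZFSet_iff.1 hx
    exact ih a ha ((Ordinal.card_le_card ha.le).trans_lt ho)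

theorem countable_iff_card_le (x : ZFSet.{u}) :
    (x : Set ZFSet.{u}).Countable ↔ x.card ≤ ℵ₀ := by
  rw [← Cardinal.le_aleph0_iff_set_countable]
  have := ZFSet.cardinalMk_coe_sort (x := x)
  change #(x : Set ZFSet.{u}) = _ at this
  rw [this, lift_le_aleph0]

/-! ### Definability in `(H(κ), ∈, ⊴)` -/

section Definability

open FirstOrder FirstOrder.Language

/-- The symbol `∈` of the language. -/
abbrev memSymbol : setLanguage.Relations 2 := SetRel.mem

/-- The symbol `⊴` of the language. -/
abbrev woSymbol : setLanguage.Relations 2 := SetRel.wo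

/-- A predicate on assignments is definable without parameters in `(H(κ), ∈, ⊴)`. -/
class IsDefinable (κ : Cardinal.{u}) (wo : H κ → H κ → Prop) (p : (ℕ → H κ) → Prop) : Prop where
  exists_formula : letI := hStructure κ wo
    ∃ φ : setLanguage.Formula ℕ, ∀ v, φ.Realize v ↔ p v

namespace IsDefinable

instance mem (i j : ℕ) :
    IsDefinable κ wo (fun v => (v i : ZFSet.{u}) ∈ (v j : ZFSet.{u})) := by
  let _ := hStructure κ wo
  refine ⟨⟨Relations.formula₂ memSymbol (Term.var i) (Term.var j), fun v => ?_⟩⟩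
  rw [Formula.realize_rel₂]
  rfl

instance wellOrder (i j : ℕ) : IsDefinable κ wo (fun v => wo (v i) (v j)) := by
  let _ := hStructure κ wo
  refine ⟨⟨Relations.formula₂ woSymbol (Term.var i) (Term.var j), fun v => ?_⟩⟩
  rw [Formula.realize_rel₂]
  rfl

instance eq (i j : ℕ) : IsDefinable κ wo (fun v => v i = v j) := by
  let _ := hStructure κ wo
  refine ⟨⟨Term.equal (L := setLanguage) (Term.var i) (Term.var j), fun v => ?_⟩⟩
  rw [Formula.realize_equal]
  rfl

instance and (p q : (ℕ → H κ) → Prop) [hp : IsDefinable κ wo p] [hq : IsDefinable κ wo q] :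
    IsDefinable κ wo (fun v => p v ∧ q v) := by
  let _ := hStructure κ wo
  obtain ⟨φ, hφ⟩ := hp
  obtain ⟨ψ, hψ⟩ := hq
  exact ⟨⟨φ ⊓ ψ, fun v => by rw [Formula.realize_inf, hφ, hψ]⟩⟩

instance not (p : (ℕ → H κ) → Prop) [hp : IsDefinable κ wo p] :
    IsDefinable κ wo (fun v => ¬ p v) := by
  let _ := hStructure κ wo
  obtain ⟨φ, hφ⟩ := hp
  exact ⟨⟨φ.not, fun v => by rw [Formula.realize_not, hφ]⟩⟩

theorem congr {p q : (ℕ → H κ) → Prop} (hp : IsDefinable κ wo p) (h : ∀ v, p v ↔ q v) :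
    IsDefinable κ wo q := by
  obtain rfl : p = q := funext fun v => propext (h v)
  exact hp

instance imp (p q : (ℕ → H κ) → Prop) [IsDefinable κ wo p] [IsDefinable κ wo q] :
    IsDefinable κ wo (fun v => p v → q v) :=
  congr (p := fun v => ¬ (p v ∧ ¬ q v)) inferInstance fun v => by tauto

instance or (p q : (ℕ → H κ) → Prop) [IsDefinable κ wo p] [IsDefinable κ wo q] :
    IsDefinable κ wo (fun v => p v ∨ q v) :=
  congr (p := fun v => ¬ p v → q v) inferInstance fun v => by tauto

instance iff (p q : (ℕ → H κ) → Prop) [IsDefinable κ wo p] [IsDefinable κ wo q] :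
    IsDefinable κ wo (fun v => p v ↔ q v) :=
  congr (p := fun v => (p v → q v) ∧ (q v → p v)) inferInstance fun v => by tauto

/-- Assignments treat the variable `0` as the bound one and shift the others. -/
instance ex (q : H κ → (ℕ → H κ) → Prop)
    [hq : IsDefinable κ wo (fun v => q (v 0) (fun n => v (n + 1)))] :
    IsDefinable κ wo (fun v => ∃ x, q x v) := by
  let _ := hStructure κ wo
  obtain ⟨φ, hφ⟩ := hq
  let g : ℕ → ℕ ⊕ Unit := fun n => Nat.casesOn n (Sum.inr ()) Sum.inl
  refine ⟨⟨(φ.relabel g).iExs Unit, fun v => ?_⟩⟩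
  rw [Formula.realize_iExs]
  have key : ∀ i : Unit → H κ, (φ.relabel g).Realize (Sum.elim v i) ↔ q (i ()) v := fun i => by
    rw [Formula.realize_relabel, hφ]
    rfl
  constructor
  · rintro ⟨i, hi⟩; exact ⟨i (), (key i).1 hi⟩
  · rintro ⟨x, hx⟩; exact ⟨fun _ => x, (key _).2 hx⟩

instance all (q : H κ → (ℕ → H κ) → Prop)
    [IsDefinable κ wo (fun v => q (v 0) (fun n => v (n + 1)))] :
    IsDefinable κ wo (fun v => ∀ x, q x v) :=
  congr (p := fun v => ¬ ∃ x, ¬ q x v) inferInstance fun v => by simp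

instance subset (i j : ℕ) : IsDefinable κ wo (fun v => (v i : ZFSet.{u}) ⊆ (v j : ZFSet.{u})) :=
  congr (p := fun v => ∀ x : H κ, (x : ZFSet.{u}) ∈ (v i : ZFSet.{u}) →
    (x : ZFSet.{u}) ∈ (v j : ZFSet.{u})) inferInstance fun v =>
    ⟨fun h z hz => h ⟨z, mem_H_of_mem (v i).2 hz⟩ hz, fun h _ hx => h hx⟩

instance coe_eq (i j : ℕ) : IsDefinable κ wo (fun v => (v i : ZFSet.{u}) = (v j : ZFSet.{u})) :=
  congr (p := fun v => v i = v j) inferInstance fun _ => Subtype.ext_iff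

theorem comp {p : (ℕ → H κ) → Prop} (hp : IsDefinable κ wo p) (g : ℕ → ℕ) :
    IsDefinable κ wo (fun v => p (fun n => v (g n))) := by
  let _ := hStructure κ wo
  obtain ⟨φ, hφ⟩ := hp
  refine ⟨⟨φ.relabel g, fun v => ?_⟩⟩
  rw [Formula.realize_relabel, hφ]
  rfl

instance eq_pairSet (i j k : ℕ) :
    IsDefinable κ wo (fun v => (v k : ZFSet.{u}) = {(v i : ZFSet.{u}), (v j : ZFSet.{u})}) :=
  congr (p := fun v => ∀ w : H κ, (w : ZFSet.{u}) ∈ (v k : ZFSet.{u}) ↔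
      (w : ZFSet.{u}) = (v i : ZFSet.{u}) ∨ (w : ZFSet.{u}) = (v j : ZFSet.{u}))
    inferInstance fun v => by
      constructor
      · intro h
        ext w
        rw [ZFSet.mem_pair]
        constructor
        · intro hw
          exact (h ⟨w, mem_H_of_mem (v k).2 hw⟩).1 hw
        · rintro (rfl | rfl)
          · exact (h (v i)).2 (.inl rfl)
          · exact (h (v j)).2 (.inr rfl)
      · intro h w
        rw [h, ZFSet.mem_pair]

instance eq_pair (i j k : ℕ) :
    IsDefinable κ wo (fun v => (v k : ZFSet.{u}) = ZFSet.pair (v i) (v j)) :=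
  congr (p := fun v =>
      (∀ z : H κ, (z : ZFSet.{u}) ∈ (v k : ZFSet.{u}) →
        (z : ZFSet.{u}) = {(v i : ZFSet.{u}), (v i : ZFSet.{u})} ∨
        (z : ZFSet.{u}) = {(v i : ZFSet.{u}), (v j : ZFSet.{u})}) ∧
      (∃ z : H κ, (z : ZFSet.{u}) ∈ (v k : ZFSet.{u}) ∧
        (z : ZFSet.{u}) = {(v i : ZFSet.{u}), (v i : ZFSet.{u})}) ∧
      (∃ z : H κ, (z : ZFSet.{u}) ∈ (v k : ZFSet.{u}) ∧
        (z : ZFSet.{u}) = {(v i : ZFSet.{u}), (v j : ZFSet.{u})}))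
    inferInstance fun v => by
      constructor
      · rintro ⟨h, ⟨y, hy, hy'⟩, ⟨z, hz, hz'⟩⟩
        ext w
        rw [ZFSet.pair, ← ZFSet.pair_eq_singleton, ZFSet.mem_pair]
        constructor
        · intro hw
          exact h ⟨w, mem_H_of_mem (v k).2 hw⟩ hw
        · rintro (rfl | rfl)
          · rwa [← hy']
          · rwa [← hz']
      · intro h
        have hm : ∀ z, z ∈ (v k : ZFSet.{u}) ↔ z = {(v i : ZFSet.{u}), (v i : ZFSet.{u})} ∨
            z = {(v i : ZFSet.{u}), (v j : ZFSet.{u})} := fun z => by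
          rw [h, ZFSet.pair_eq_singleton, ZFSet.pair, ZFSet.mem_pair]
        refine ⟨fun z hz => (hm z).1 hz, ?_, ?_⟩
        · have := (hm _).2 (.inl rfl)
          exact ⟨⟨_, mem_H_of_mem (v k).2 this⟩, this, rfl⟩
        · have := (hm _).2 (.inr rfl)
          exact ⟨⟨_, mem_H_of_mem (v k).2 this⟩, this, rfl⟩

instance pair_mem (i j k : ℕ) :
    IsDefinable κ wo (fun v => ZFSet.pair (v i) (v j) ∈ (v k : ZFSet.{u})) :=
  congr (p := fun v => ∃ q : H κ, (q : ZFSet.{u}) ∈ (v k : ZFSet.{u}) ∧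
      (q : ZFSet.{u}) = ZFSet.pair (v i) (v j)) inferInstance fun v => by
    constructor
    · rintro ⟨q, hq, h⟩
      rwa [← h]
    · intro h
      exact ⟨⟨_, mem_H_of_mem (v k).2 h⟩, h, rfl⟩

instance pair_pair_mem (i j k l : ℕ) :
    IsDefinable κ wo (fun v => ZFSet.pair (ZFSet.pair (v i) (v j)) (v k) ∈ (v l : ZFSet.{u})) :=
  congr (p := fun v => ∃ q : H κ, (q : ZFSet.{u}) = ZFSet.pair (v i) (v j) ∧
      ZFSet.pair q (v k) ∈ (v l : ZFSet.{u})) inferInstance fun v => by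
    constructor
    · rintro ⟨q, h, hq⟩
      rwa [← h]
    · intro h
      have h1 : {ZFSet.pair (v i : ZFSet.{u}) (v j : ZFSet.{u})} ∈ H κ :=
        mem_H_of_mem (mem_H_of_mem (v l).2 h) (by simp [ZFSet.pair])
      exact ⟨⟨_, mem_H_of_mem h1 (ZFSet.mem_singleton.2 rfl)⟩, rfl, h⟩

end IsDefinable

/-- The assignment that sends the variable `0` to `x` and is shifted by one elsewhere. -/
def scons {α : Type*} (x : α) (v : ℕ → α) : ℕ → α
  | 0 => x
  | n + 1 => v n

/-- The half of elementarity used below: an existential statement with parameters in `M` has a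
witness in `M`. -/
theorem IsSub.exists_mem {M : ZFSet.{u}} (hM : IsSub κ wo M) {p : (ℕ → H κ) → Prop}
    (hp : IsDefinable κ wo p) (v : ℕ → H κ) (hv : ∀ n, (v n : ZFSet.{u}) ∈ M)
    (h : ∃ x, p (scons x v)) : ∃ x : H κ, (x : ZFSet.{u}) ∈ M ∧ p (scons x v) := by
  let _ := hStructure κ wo
  obtain ⟨φ, hφ⟩ := hp
  obtain ⟨S, hS⟩ := hM.elementary
  let g : ℕ → ℕ ⊕ Unit := fun n => Nat.casesOn n (Sum.inr ()) Sum.inl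
  let v' : ℕ → S := fun n => ⟨v n, (hS _).2 (hv n)⟩
  have hg : ∀ (i : Unit → H κ), Sum.elim v i ∘ g = scons (i ()) v := fun i => by
    funext n
    cases n <;> rfl
  have h1 : ((φ.relabel g).iExs Unit).Realize v := by
    obtain ⟨x, hx⟩ := h
    rw [Formula.realize_iExs]
    refine ⟨fun _ => x, ?_⟩
    rwa [Formula.realize_relabel, hg, hφ]
  have h2 : ((φ.relabel g).iExs Unit).Realize v' :=
    (S.subtype.map_formula _ v').1 h1
  rw [Formula.realize_iExs] at h2
  obtain ⟨i, hi⟩ := h2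
  refine ⟨i (), (hS _).1 (i ()).2, ?_⟩
  rw [← S.subtype.map_formula, Formula.realize_relabel, hφ] at hi
  convert hi using 1
  funext n
  cases n <;> rfl

/-- The `⊴`-least witness of a definable property lies in every elementary submodel that contains
the parameters; in particular the same witness serves several submodels at once. -/
theorem exists_canonical (hwo : IsWellOrder (H κ) wo) (p : H κ → H κ → H κ → H κ → Prop)
    [hp : IsDefinable κ wo (fun v => p (v 0) (v 1) (v 2) (v 3))] (a b c : H κ)
    (h : ∃ x, p x a b c) :
    ∃ x, p x a b c ∧ ∀ M : ZFSet.{u}, IsSub κ wo M → (a : ZFSet.{u}) ∈ M → (b : ZFSet.{u}) ∈ M →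
      (c : ZFSet.{u}) ∈ M → (x : ZFSet.{u}) ∈ M := by
  let s : Set (H κ) := {x | p x a b c}
  have hwf : WellFounded wo := hwo.wf
  let x := hwf.min s h
  have hx : p x a b c := hwf.min_mem s h
  have hleast : ∀ y, p y a b c → ¬ wo y x := fun y hy => hwf.not_lt_min s hy
  refine ⟨x, hx, fun M hM ha hb hc => ?_⟩
  have hq : IsDefinable κ wo (fun v => p (v 0) (v 1) (v 2) (v 3) ∧
      ∀ y, p y (v 1) (v 2) (v 3) → ¬ wo y (v 0)) := by
    have : IsDefinable κ wo (fun v => p (v 0) (v (1 + 1)) (v (2 + 1)) (v (3 + 1))) :=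
      hp.comp (fun n => Nat.casesOn n 0 (fun m => m + 1 + 1))
    infer_instance
  let v : ℕ → H κ := scons a (scons b (fun _ => c))
  obtain ⟨y, hyM, hy, hyl⟩ := hM.exists_mem hq v
    (by rintro (_ | _ | n) <;> assumption) ⟨x, hx, hleast⟩
  have : x = y := hwo.toTrichotomous.trichotomous _ _ (hyl x hx) (hleast y hy)
  rw [this]
  exact hyM

theorem IsSub.mem_of_definable {M : ZFSet.{u}} (hM : IsSub κ wo M) (hwo : IsWellOrder (H κ) wo)
    (p : H κ → H κ → H κ → H κ → Prop)
    [hp : IsDefinable κ wo (fun v => p (v 0) (v 1) (v 2) (v 3))] {x a b c : H κ}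
    (hx : p x a b c) (huniq : ∀ y, p y a b c → y = x) (ha : (a : ZFSet.{u}) ∈ M)
    (hb : (b : ZFSet.{u}) ∈ M) (hc : (c : ZFSet.{u}) ∈ M) : (x : ZFSet.{u}) ∈ M := by
  obtain ⟨y, hy, hyM⟩ := exists_canonical hwo p a b c ⟨x, hx⟩
  rw [← huniq y hy]
  exact hyM M hM ha hb hc

end Definability

/-! ### Injections and closure properties of elementary submodels -/

theorem mem_H_of_pair_mem {x y f : ZFSet.{u}} (hf : f ∈ H κ) (h : ZFSet.pair x y ∈ f) :
    x ∈ H κ ∧ y ∈ H κ := by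
  have h1 : ({x, y} : ZFSet.{u}) ∈ H κ :=
    mem_H_of_mem (mem_H_of_mem hf h) (ZFSet.mem_pair.2 (.inr rfl))
  exact ⟨mem_H_of_mem h1 (ZFSet.mem_pair.2 (.inl rfl)),
    mem_H_of_mem h1 (ZFSet.mem_pair.2 (.inr rfl))⟩

/-- `f` is (the graph of) an injection from `a` to `b`. -/
structure IsInjection (f a b : ZFSet.{u}) : Prop where
  total : ∀ x ∈ a, ∃ y, ZFSet.pair x y ∈ f
  dom_cod : ∀ x y, ZFSet.pair x y ∈ f → x ∈ a ∧ y ∈ b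
  functional : ∀ x y y', ZFSet.pair x y ∈ f → ZFSet.pair x y' ∈ f → y = y'
  injective : ∀ x x' y, ZFSet.pair x y ∈ f → ZFSet.pair x' y ∈ f → x = x'

instance IsDefinable.isInjection (i j k : ℕ) :
    IsDefinable κ wo (fun v => IsInjection (v i : ZFSet.{u}) (v j) (v k)) :=
  congr (p := fun v => (∀ x : H κ, (x : ZFSet.{u}) ∈ (v j : ZFSet.{u}) →
      ∃ y : H κ, ZFSet.pair x y ∈ (v i : ZFSet.{u})) ∧
    (∀ x y : H κ, ZFSet.pair x y ∈ (v i : ZFSet.{u}) →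
      (x : ZFSet.{u}) ∈ (v j : ZFSet.{u}) ∧ (y : ZFSet.{u}) ∈ (v k : ZFSet.{u})) ∧
    (∀ x y y' : H κ, ZFSet.pair x y ∈ (v i : ZFSet.{u}) → ZFSet.pair x y' ∈ (v i : ZFSet.{u}) →
      (y : ZFSet.{u}) = (y' : ZFSet.{u})) ∧
    (∀ x x' y : H κ, ZFSet.pair x y ∈ (v i : ZFSet.{u}) → ZFSet.pair x' y ∈ (v i : ZFSet.{u}) →
      (x : ZFSet.{u}) = (x' : ZFSet.{u}))) inferInstance fun v => by
    have hP : ∀ {x y : ZFSet.{u}}, ZFSet.pair x y ∈ (v i : ZFSet.{u}) → x ∈ H κ ∧ y ∈ H κ :=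
      fun h => mem_H_of_pair_mem (v i).2 h
    constructor
    · rintro ⟨h1, h2, h3, h4⟩
      refine ⟨fun x hx => ?_, fun x y h => ?_, fun x y y' h h' => ?_, fun x x' y h h' => ?_⟩
      · obtain ⟨y, hy⟩ := h1 ⟨x, mem_H_of_mem (v j).2 hx⟩ hx
        exact ⟨y, hy⟩
      · exact h2 ⟨x, (hP h).1⟩ ⟨y, (hP h).2⟩ h
      · exact h3 ⟨x, (hP h).1⟩ ⟨y, (hP h).2⟩ ⟨y', (hP h').2⟩ h h'
      · exact h4 ⟨x, (hP h).1⟩ ⟨x', (hP h').1⟩ ⟨y, (hP h).2⟩ h h'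
    · rintro ⟨h1, h2, h3, h4⟩
      refine ⟨fun x hx => ?_, fun x y h => h2 x y h, fun x y y' h h' => h3 x y y' h h',
        fun x x' y h h' => h4 x x' y h h'⟩
      obtain ⟨y, hy⟩ := h1 x hx
      exact ⟨⟨y, (hP hy).2⟩, hy⟩

theorem card_lt_of_mem_H {x : ZFSet.{u}} (hx : x ∈ H κ) : x.card < κ :=
  (ZFSet.card_mono (subset_trcl x)).trans_lt hx

theorem exists_isInjection (hκ : κ.IsRegular) {a b : ZFSet.{u}} (ha : a ∈ H κ) (hb : b ∈ H κ)
    (hab : a.card ≤ b.card) : ∃ f ∈ H κ, IsInjection f a b := by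
  obtain ⟨e⟩ : #(Shrink.{u} a) ≤ #(Shrink.{u} b) := hab
  let g : Shrink.{u} a → ZFSet.{u} := fun i => ((equivShrink a).symm i : a)
  let g' : Shrink.{u} b → ZFSet.{u} := fun i => ((equivShrink b).symm i : b)
  have hg : ∀ i, g i ∈ a := fun i => Subtype.prop _
  have hg' : ∀ i, g' i ∈ b := fun i => Subtype.prop _
  have ginj : Function.Injective g := Subtype.val_injective.comp (equivShrink a).symm.injective
  have ginj' : Function.Injective g' := Subtype.val_injective.comp (equivShrink b).symm.injective
  refine ⟨ZFSet.range fun i => ZFSet.pair (g i) (g' (e i)),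
    range_mem_H hκ (card_lt_of_mem_H ha) fun i =>
      pair_mem_H hκ (mem_H_of_mem ha (hg i)) (mem_H_of_mem hb (hg' _)), ?_, ?_, ?_, ?_⟩
  · intro x hx
    refine ⟨g' (e (equivShrink a ⟨x, hx⟩)), ZFSet.mem_range.2 ⟨equivShrink a ⟨x, hx⟩, ?_⟩⟩
    simp [g]
  · intro x y h
    obtain ⟨i, hi⟩ := ZFSet.mem_range.1 h
    obtain ⟨rfl, rfl⟩ := ZFSet.pair_injective hi
    exact ⟨hg _, hg' _⟩
  · intro x y y' h h'
    obtain ⟨i, hi⟩ := ZFSet.mem_range.1 h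
    obtain ⟨rfl, rfl⟩ := ZFSet.pair_injective hi
    obtain ⟨j, hj⟩ := ZFSet.mem_range.1 h'
    obtain ⟨h1, rfl⟩ := ZFSet.pair_injective hj
    rw [ginj h1]
  · intro x x' y h h'
    obtain ⟨i, hi⟩ := ZFSet.mem_range.1 h
    obtain ⟨rfl, rfl⟩ := ZFSet.pair_injective hi
    obtain ⟨j, hj⟩ := ZFSet.mem_range.1 h'
    obtain ⟨rfl, h1⟩ := ZFSet.pair_injective hj
    rw [e.injective (ginj' h1)]

theorem IsInjection.card_le {f a b : ZFSet.{u}} (hf : IsInjection f a b) : a.card ≤ b.card := by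
  choose g hg using hf.total
  rw [← lift_le.{u + 1}, ← ZFSet.cardinalMk_coe_sort, ← ZFSet.cardinalMk_coe_sort]
  refine mk_le_of_injective (f := fun x : a => (⟨g x x.2, (hf.dom_cod _ _ (hg x x.2)).2⟩ : b)) ?_
  intro x x' h
  have h1 : g x x.2 = g x' x'.2 := congrArg Subtype.val h
  exact Subtype.ext (hf.injective _ _ _ (hg x x.2) (h1 ▸ hg x' x'.2))

theorem exists_canonical_injection (hκ : κ.IsRegular) (hwo : IsWellOrder (H κ) wo)
    {a b : ZFSet.{u}} (ha : a ∈ H κ) (hb : b ∈ H κ) (hab : a.card ≤ b.card) :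
    ∃ f, IsInjection f a b ∧ ∀ M, IsSub κ wo M → a ∈ M → b ∈ M → f ∈ M := by
  obtain ⟨f, hfH, hf⟩ := exists_isInjection hκ ha hb hab
  obtain ⟨g, hg, hgM⟩ := exists_canonical hwo
    (fun f a b _ => IsInjection (f : ZFSet.{u}) a b) ⟨a, ha⟩ ⟨b, hb⟩ ⟨b, hb⟩ ⟨⟨f, hfH⟩, hf⟩
  exact ⟨g, hg, fun M hM h1 h2 => hgM M hM h1 h2 h2⟩

namespace IsSub

variable {M : ZFSet.{u}}

/-- A set of `H(κ)` whose elements are described by a definable property with parameters in `M`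
lies in `M`. -/
theorem mem_of_ext (hM : IsSub κ wo M) (hwo : IsWellOrder (H κ) wo)
    (q : H κ → H κ → H κ → H κ → Prop)
    [hq : IsDefinable κ wo (fun v => q (v 0) (v 1) (v 2) (v 3))] {x : ZFSet.{u}} {a b c : H κ}
    (hxH : x ∈ H κ) (hx : ∀ z : H κ, (z : ZFSet.{u}) ∈ x ↔ q z a b c)
    (ha : (a : ZFSet.{u}) ∈ M) (hb : (b : ZFSet.{u}) ∈ M) (hc : (c : ZFSet.{u}) ∈ M) : x ∈ M := by
  have : IsDefinable κ wo (fun v => q (v 0) (v (1 + 1)) (v (2 + 1)) (v (3 + 1))) :=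
    hq.comp (fun n => Nat.casesOn n 0 (fun m => m + 1 + 1))
  refine hM.mem_of_definable hwo (fun x a b c => ∀ z : H κ, (z : ZFSet.{u}) ∈ (x : ZFSet.{u}) ↔
    q z a b c) (x := ⟨x, hxH⟩) hx (fun y hy => ?_) ha hb hc
  ext z
  constructor
  · intro hz
    exact (hx ⟨z, mem_H_of_mem y.2 hz⟩).2 ((hy ⟨z, mem_H_of_mem y.2 hz⟩).1 hz)
  · intro hz
    exact (hy ⟨z, mem_H_of_mem hxH hz⟩).2 ((hx ⟨z, mem_H_of_mem hxH hz⟩).1 hz)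

theorem insert_mem (hM : IsSub κ wo M) (hwo : IsWellOrder (H κ) wo) (hκ : κ.IsRegular)
    {x s : ZFSet.{u}} (hx : x ∈ M) (hs : s ∈ M) : insert x s ∈ M :=
  hM.mem_of_ext hwo (fun z a b _ => (z : ZFSet.{u}) = (a : ZFSet.{u}) ∨
      (z : ZFSet.{u}) ∈ (b : ZFSet.{u})) (a := ⟨x, hM.subset x hx⟩) (b := ⟨s, hM.subset s hs⟩)
    (c := ⟨s, hM.subset s hs⟩) (insert_mem_H hκ (hM.subset x hx) (hM.subset s hs))
    (fun _ => ZFSet.mem_insert_iff) hx hs hs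

theorem sdiff_mem (hM : IsSub κ wo M) (hwo : IsWellOrder (H κ) wo)
    {x s : ZFSet.{u}} (hx : x ∈ M) (hs : s ∈ M) : x \ s ∈ M :=
  hM.mem_of_ext hwo (fun z a b _ => (z : ZFSet.{u}) ∈ (a : ZFSet.{u}) ∧
      ¬ (z : ZFSet.{u}) ∈ (b : ZFSet.{u})) (a := ⟨x, hM.subset x hx⟩) (b := ⟨s, hM.subset s hs⟩)
    (c := ⟨s, hM.subset s hs⟩) (mem_H_of_subset (hM.subset x hx) fun _ h => (ZFSet.mem_sdiff.1 h).1)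
    (fun _ => ZFSet.mem_sdiff) hx hs hs

theorem inter_mem (hM : IsSub κ wo M) (hwo : IsWellOrder (H κ) wo)
    {x s : ZFSet.{u}} (hx : x ∈ M) (hs : s ∈ M) : x ∩ s ∈ M :=
  hM.mem_of_ext hwo (fun z a b _ => (z : ZFSet.{u}) ∈ (a : ZFSet.{u}) ∧
      (z : ZFSet.{u}) ∈ (b : ZFSet.{u})) (a := ⟨x, hM.subset x hx⟩) (b := ⟨s, hM.subset s hs⟩)
    (c := ⟨s, hM.subset s hs⟩) (mem_H_of_subset (hM.subset x hx) fun _ h => (ZFSet.mem_inter.1 h).1)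
    (fun _ => ZFSet.mem_inter) hx hs hs

theorem sdiff_sUnion_mem (hM : IsSub κ wo M) (hwo : IsWellOrder (H κ) wo)
    {x s : ZFSet.{u}} (hx : x ∈ M) (hs : s ∈ M) : x \ ⋃₀ s ∈ M :=
  hM.mem_of_ext hwo (fun z a b _ => (z : ZFSet.{u}) ∈ (a : ZFSet.{u}) ∧
      ¬ ∃ y : H κ, (y : ZFSet.{u}) ∈ (b : ZFSet.{u}) ∧ (z : ZFSet.{u}) ∈ (y : ZFSet.{u}))
    (a := ⟨x, hM.subset x hx⟩) (b := ⟨s, hM.subset s hs⟩)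
    (c := ⟨s, hM.subset s hs⟩) (mem_H_of_subset (hM.subset x hx) fun _ h => (ZFSet.mem_sdiff.1 h).1)
    (fun z => by
      rw [ZFSet.mem_sdiff, ZFSet.mem_sUnion]
      refine and_congr_right fun _ => not_congr ⟨?_, ?_⟩
      · rintro ⟨y, hy, hz⟩; exact ⟨⟨y, mem_H_of_mem (hM.subset s hs) hy⟩, hy, hz⟩
      · rintro ⟨y, hy, hz⟩; exact ⟨y, hy, hz⟩) hx hs hs

theorem image_mem (hM : IsSub κ wo M) (hwo : IsWellOrder (H κ) wo) {f a b x : ZFSet.{u}}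
    (hb : b ∈ H κ) (hf : IsInjection f a b) (hfM : f ∈ M) (hx : x ∈ M) :
    b.sep (fun y => ∃ z ∈ x, ZFSet.pair z y ∈ f) ∈ M :=
  hM.mem_of_ext hwo (fun y f x _ => ∃ z : H κ, (z : ZFSet.{u}) ∈ (x : ZFSet.{u}) ∧
      ZFSet.pair z y ∈ (f : ZFSet.{u})) (a := ⟨f, hM.subset f hfM⟩) (b := ⟨x, hM.subset x hx⟩)
    (c := ⟨x, hM.subset x hx⟩) (mem_H_of_subset hb ZFSet.sep_subset)
    (fun y => by
      rw [ZFSet.mem_sep]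
      constructor
      · rintro ⟨-, z, hz, h⟩; exact ⟨⟨z, mem_H_of_mem (hM.subset x hx) hz⟩, hz, h⟩
      · rintro ⟨z, hz, h⟩; exact ⟨(hf.dom_cod _ _ h).2, z, hz, h⟩) hfM hx hx

theorem preimage_mem (hM : IsSub κ wo M) (hwo : IsWellOrder (H κ) wo) {f a b x : ZFSet.{u}}
    (ha : a ∈ H κ) (hf : IsInjection f a b) (hfM : f ∈ M) (hx : x ∈ M) :
    a.sep (fun y => ∃ z ∈ x, ZFSet.pair y z ∈ f) ∈ M :=
  hM.mem_of_ext hwo (fun y f x _ => ∃ z : H κ, (z : ZFSet.{u}) ∈ (x : ZFSet.{u}) ∧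
      ZFSet.pair y z ∈ (f : ZFSet.{u})) (a := ⟨f, hM.subset f hfM⟩) (b := ⟨x, hM.subset x hx⟩)
    (c := ⟨x, hM.subset x hx⟩) (mem_H_of_subset ha ZFSet.sep_subset)
    (fun y => by
      rw [ZFSet.mem_sep]
      constructor
      · rintro ⟨-, z, hz, h⟩; exact ⟨⟨z, mem_H_of_mem (hM.subset x hx) hz⟩, hz, h⟩
      · rintro ⟨z, hz, h⟩; exact ⟨(hf.dom_cod _ _ h).1, z, hz, h⟩) hfM hx hx

theorem powerset_mem (hM : IsSub κ wo M) (hwo : IsWellOrder (H κ) wo) {x : ZFSet.{u}}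
    (hx : x ∈ M) (hp : x.powerset ∈ H κ) : x.powerset ∈ M :=
  hM.mem_of_ext hwo (fun z a _ _ => (z : ZFSet.{u}) ⊆ (a : ZFSet.{u})) (a := ⟨x, hM.subset x hx⟩)
    (b := ⟨x, hM.subset x hx⟩) (c := ⟨x, hM.subset x hx⟩) hp
    (fun _ => ZFSet.mem_powerset) hx hx hx

theorem apply_mem (hM : IsSub κ wo M) (hwo : IsWellOrder (H κ) wo) {f a b x y : ZFSet.{u}}
    (hf : IsInjection f a b) (hfM : f ∈ M) (hx : x ∈ M) (h : ZFSet.pair x y ∈ f) : y ∈ M :=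
  hM.mem_of_definable hwo (fun y f x _ => ZFSet.pair x y ∈ (f : ZFSet.{u}))
    (x := ⟨y, (mem_H_of_pair_mem (hM.subset f hfM) h).2⟩) (a := ⟨f, hM.subset f hfM⟩)
    (b := ⟨x, hM.subset x hx⟩) (c := ⟨x, hM.subset x hx⟩) h
    (fun _ h' => Subtype.ext (hf.functional _ _ _ h' h)) hfM hx hx

theorem symm_apply_mem (hM : IsSub κ wo M) (hwo : IsWellOrder (H κ) wo) {f a b x y : ZFSet.{u}}
    (hf : IsInjection f a b) (hfM : f ∈ M) (hy : y ∈ M) (h : ZFSet.pair x y ∈ f) : x ∈ M :=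
  hM.mem_of_definable hwo (fun x f y _ => ZFSet.pair x y ∈ (f : ZFSet.{u}))
    (x := ⟨x, (mem_H_of_pair_mem (hM.subset f hfM) h).1⟩) (a := ⟨f, hM.subset f hfM⟩)
    (b := ⟨y, hM.subset y hy⟩) (c := ⟨y, hM.subset y hy⟩) h
    (fun _ h' => Subtype.ext (hf.injective _ _ _ h' h)) hfM hy hy

end IsSub

/-! ### The ordinals `ω_l` and heights -/

theorem card_omegaSet (l : ℕ) : (omegaSet.{u} l).card = ℵ_ (l : Ordinal.{u}) := by
  rw [omegaSet, Ordinal.card_toZFSet, Ordinal.card_omega]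

theorem omegaSet_mem_H (hκ : κ.IsRegular) {l : ℕ} (hl : ℵ_ (l : Ordinal.{u}) < κ) :
    omegaSet.{u} l ∈ H κ :=
  toZFSet_mem_H hκ (by rwa [Ordinal.card_omega])

theorem toZFSet_mem_omegaSet {a : Ordinal.{u}} {l : ℕ} :
    a.toZFSet ∈ omegaSet l ↔ a < Ordinal.omega l :=
  Ordinal.toZFSet_mem_toZFSet_iff

theorem mem_omegaSet {x : ZFSet.{u}} {l : ℕ} :
    x ∈ omegaSet l ↔ ∃ a < Ordinal.omega (l : Ordinal.{u}), a.toZFSet = x :=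
  Ordinal.mem_toZFSet_iff

theorem card_le_of_mem_omegaSet_succ {x : ZFSet.{u}} {l : ℕ} (h : x ∈ omegaSet (l + 1)) :
    x.card ≤ ℵ_ (l : Ordinal.{u}) := by
  obtain ⟨a, ha, rfl⟩ := mem_omegaSet.1 h
  rw [Ordinal.card_toZFSet]
  rw [lt_omega_iff_card_lt, Nat.cast_succ, ← succ_aleph] at ha
  exact Order.lt_succ_iff.1 ha

instance IsDefinable.isTransitive (i : ℕ) :
    IsDefinable κ wo (fun v => (v i : ZFSet.{u}).IsTransitive) :=
  congr (p := fun v => ∀ x : H κ, (x : ZFSet.{u}) ∈ (v i : ZFSet.{u}) →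
    (x : ZFSet.{u}) ⊆ (v i : ZFSet.{u})) inferInstance fun v =>
    ⟨fun h x hx => h ⟨x, mem_H_of_mem (v i).2 hx⟩ hx, fun h x hx => h x hx⟩

instance IsDefinable.isOrdinal (i : ℕ) :
    IsDefinable κ wo (fun v => (v i : ZFSet.{u}).IsOrdinal) :=
  congr (p := fun v => (v i : ZFSet.{u}).IsTransitive ∧
      ∀ x : H κ, (x : ZFSet.{u}) ∈ (v i : ZFSet.{u}) → (x : ZFSet.{u}).IsTransitive)
    inferInstance fun v => by
    rw [ZFSet.isOrdinal_iff_forall_mem_isTransitive]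
    exact and_congr_right fun _ =>
      ⟨fun h x hx => h ⟨x, mem_H_of_mem (v i).2 hx⟩ hx, fun h x hx => h x hx⟩

/-- `x` is nonempty and every element of `x` belongs to an element of `x`; for an ordinal this says
that it is a nonzero limit. -/
def IsLimitLike (x : ZFSet.{u}) : Prop :=
  (∃ y, y ∈ x) ∧ ∀ y ∈ x, ∃ z ∈ x, y ∈ z

instance IsDefinable.isLimitLike (i : ℕ) :
    IsDefinable κ wo (fun v => IsLimitLike (v i : ZFSet.{u})) :=
  congr (p := fun v => (∃ x : H κ, (x : ZFSet.{u}) ∈ (v i : ZFSet.{u})) ∧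
      ∀ x : H κ, (x : ZFSet.{u}) ∈ (v i : ZFSet.{u}) → ∃ z : H κ,
        (z : ZFSet.{u}) ∈ (v i : ZFSet.{u}) ∧ (x : ZFSet.{u}) ∈ (z : ZFSet.{u}))
    inferInstance fun v => by
    have hH : ∀ {x : ZFSet.{u}}, x ∈ (v i : ZFSet.{u}) → x ∈ H κ := mem_H_of_mem (v i).2
    constructor
    · rintro ⟨⟨x, hx⟩, h⟩
      refine ⟨⟨x, hx⟩, fun y hy => ?_⟩
      obtain ⟨z, hz, hyz⟩ := h ⟨y, hH hy⟩ hy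
      exact ⟨z, hz, hyz⟩
    · rintro ⟨⟨x, hx⟩, h⟩
      refine ⟨⟨⟨x, hH hx⟩, hx⟩, fun y hy => ?_⟩
      obtain ⟨z, hz, hyz⟩ := h y hy
      exact ⟨⟨z, hH hz⟩, hz, hyz⟩

theorem isLimitLike_toZFSet {a : Ordinal.{u}} : IsLimitLike a.toZFSet ↔ Order.IsSuccLimit a := by
  constructor
  · rintro ⟨⟨y, hy⟩, h⟩
    obtain ⟨b, hb, rfl⟩ := Ordinal.mem_toZFSet_iff.1 hy
    refine (Order.isSuccLimit_iff _).2 ⟨fun hmin => hmin.not_lt hb, ?_⟩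
    intro c hc
    obtain ⟨z, hz, hcz⟩ := h c.toZFSet (Ordinal.toZFSet_mem_toZFSet_iff.2 hc.1)
    obtain ⟨e, he, rfl⟩ := Ordinal.mem_toZFSet_iff.1 hz
    exact hc.2 (Ordinal.toZFSet_mem_toZFSet_iff.1 hcz) he
  · intro h
    refine ⟨⟨(0 : Ordinal).toZFSet, Ordinal.toZFSet_mem_toZFSet_iff.2 h.bot_lt⟩, fun y hy => ?_⟩
    obtain ⟨b, hb, rfl⟩ := Ordinal.mem_toZFSet_iff.1 hy
    exact ⟨(Order.succ b).toZFSet, Ordinal.toZFSet_mem_toZFSet_iff.2 (h.succ_lt hb),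
      Ordinal.toZFSet_mem_toZFSet_iff.2 (Order.lt_succ b)⟩

namespace IsSub

variable {M : ZFSet.{u}}

theorem empty_mem (hM : IsSub κ wo M) (hwo : IsWellOrder (H κ) wo) (hne : M.Nonempty) :
    (∅ : ZFSet.{u}) ∈ M := by
  obtain ⟨x, hx⟩ := hne
  have := hM.sdiff_mem hwo hx hx
  convert this using 1
  ext z
  simp

theorem mem_of_finite (hM : IsSub κ wo M) (hwo : IsWellOrder (H κ) wo) (hκ : κ.IsRegular)
    (hne : M.Nonempty) {s : Set ZFSet.{u}} (hs : s.Finite) (h : ∀ x ∈ s, x ∈ M) :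
    ∃ x ∈ M, ∀ z, z ∈ x ↔ z ∈ s := by
  induction s, hs using Set.Finite.induction_on with
  | empty => exact ⟨∅, hM.empty_mem hwo hne, by simp⟩
  | @insert a s _ _ ih =>
    obtain ⟨x, hx, hxs⟩ := ih fun y hy => h y (Set.mem_insert_of_mem _ hy)
    exact ⟨insert a x, hM.insert_mem hwo hκ (h a (Set.mem_insert _ _)) hx, fun z => by simp [hxs]⟩

/-- `ω` is the least nonzero limit ordinal, and `ω_(k+1)` is the least ordinal without an injection
into `ω_k`, so every `ω_l` is definable. -/
theorem omegaSet_mem (hM : IsSub κ wo M) (hwo : IsWellOrder (H κ) wo) (hκ : κ.IsRegular)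
    (hne : M.Nonempty) {l : ℕ} (hl : ℵ_ (l : Ordinal.{u}) < κ) : omegaSet l ∈ M := by
  obtain ⟨w, hw⟩ := hne
  induction l with
  | zero =>
    let w' : H κ := ⟨w, hM.subset w hw⟩
    refine hM.mem_of_definable hwo (fun x _ _ _ => (x : ZFSet.{u}).IsOrdinal ∧
      IsLimitLike (x : ZFSet.{u}) ∧ ∀ y : H κ, (y : ZFSet.{u}) ∈ (x : ZFSet.{u}) →
      ¬ IsLimitLike (y : ZFSet.{u})) (x := ⟨omegaSet 0, omegaSet_mem_H hκ hl⟩) (a := w') (b := w')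
      (c := w') ?_ ?_ hw hw hw
    · refine ⟨ZFSet.isOrdinal_toZFSet _, isLimitLike_toZFSet.2 (isSuccLimit_omega _),
        fun y hy hlim => ?_⟩
      obtain ⟨a, ha, h⟩ := mem_omegaSet.1 hy
      rw [← h, isLimitLike_toZFSet] at hlim
      rw [Nat.cast_zero, Ordinal.omega_zero] at ha
      exact ha.not_ge (Ordinal.omega0_le_of_isSuccLimit hlim)
    · rintro ⟨y, hyH⟩ ⟨h1, h2, h3⟩
      apply Subtype.ext
      obtain ⟨a, rfl⟩ := ZFSet.isOrdinal_iff_mem_range_toZFSet.1 h1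
      have h4 := Ordinal.omega0_le_of_isSuccLimit (isLimitLike_toZFSet.1 h2)
      rcases h4.eq_or_lt with h5 | h5
      · simp [omegaSet, h5]
      · have h6 : Ordinal.omega0.toZFSet ∈ a.toZFSet := Ordinal.toZFSet_mem_toZFSet_iff.2 h5
        exact absurd (isLimitLike_toZFSet.2 Ordinal.isSuccLimit_omega0)
          (h3 ⟨_, mem_H_of_mem hyH h6⟩ h6)
  | succ k ih =>
    have hk : ℵ_ (k : Ordinal.{u}) < κ :=
      (aleph_le_aleph.2 (by exact_mod_cast k.le_succ)).trans_lt hl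
    have hkM := ih hk
    have hkH := omegaSet_mem_H hκ hk
    let w' : H κ := ⟨omegaSet k, hkH⟩
    have hsucc : ℵ_ ((k + 1 : ℕ) : Ordinal.{u}) = Order.succ (ℵ_ (k : Ordinal.{u})) := by
      rw [Nat.cast_succ, ← succ_aleph]
    refine hM.mem_of_definable hwo (fun x a _ _ => (x : ZFSet.{u}).IsOrdinal ∧
      (¬ ∃ f : H κ, IsInjection (f : ZFSet.{u}) x a) ∧
      ∀ y : H κ, (y : ZFSet.{u}) ∈ (x : ZFSet.{u}) → ∃ f : H κ, IsInjection (f : ZFSet.{u}) y a)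
      (x := ⟨omegaSet (k + 1), omegaSet_mem_H hκ hl⟩) (a := w') (b := w')
      (c := w') ?_ ?_ hkM hkM hkM
    · refine ⟨ZFSet.isOrdinal_toZFSet _, ?_, ?_⟩
      · rintro ⟨f, hf⟩
        have := hf.card_le
        rw [card_omegaSet, card_omegaSet, hsucc] at this
        exact this.not_gt (Order.lt_succ _)
      · intro y hy
        obtain ⟨f, hfH, hf⟩ := exists_isInjection hκ y.2 hkH
          ((card_le_of_mem_omegaSet_succ hy).trans_eq (card_omegaSet k).symm)
        exact ⟨⟨f, hfH⟩, hf⟩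
    · rintro ⟨y, hyH⟩ ⟨h1, h2, h3⟩
      apply Subtype.ext
      obtain ⟨a, rfl⟩ := ZFSet.isOrdinal_iff_mem_range_toZFSet.1 h1
      have h4 : ¬ a < Ordinal.omega ((k + 1 : ℕ) : Ordinal.{u}) := by
        intro ha
        obtain ⟨f, hfH, hf⟩ := exists_isInjection hκ hyH hkH
          ((card_le_of_mem_omegaSet_succ (toZFSet_mem_omegaSet.2 ha)).trans_eq
            (card_omegaSet k).symm)
        exact h2 ⟨⟨f, hfH⟩, hf⟩
      rcases (not_lt.1 h4).eq_or_lt with h5 | h5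
      · simp only [omegaSet, h5]
      · have h6 : omegaSet (k + 1) ∈ a.toZFSet := Ordinal.toZFSet_mem_toZFSet_iff.2 h5
        obtain ⟨f, hf⟩ := h3 ⟨_, mem_H_of_mem hyH h6⟩ h6
        have := hf.card_le
        rw [card_omegaSet, card_omegaSet, hsucc] at this
        exact absurd (Order.lt_succ _) this.not_gt

theorem natCast_mem (hM : IsSub κ wo M) (hwo : IsWellOrder (H κ) wo) (hκ : κ.IsRegular)
    (hne : M.Nonempty) (n : ℕ) : (n : Ordinal.{u}).toZFSet ∈ M := by
  induction n with
  | zero => simpa using hM.empty_mem hwo hne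
  | succ n ih =>
    rw [Nat.cast_succ, Ordinal.toZFSet_add_one]
    exact hM.insert_mem hwo hκ ih ih

theorem subset_of_countable (hM : IsSub κ wo M) (hwo : IsWellOrder (H κ) wo) (hκ : κ.IsRegular)
    (h0 : ℵ₀ < κ) {A : ZFSet.{u}} (hA : A ∈ M) (hc : (A : Set ZFSet.{u}).Countable) : A ⊆ M := by
  have hne : M.Nonempty := ⟨A, hA⟩
  have h0' : ℵ_ ((0 : ℕ) : Ordinal.{u}) = ℵ₀ := by simp
  obtain ⟨f, hf, hfM⟩ := exists_canonical_injection hκ hwo (hM.subset A hA)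
    (omegaSet_mem_H hκ (l := 0) (h0'.trans_lt h0))
    (((countable_iff_card_le A).1 hc).trans_eq (h0'.symm.trans (card_omegaSet 0).symm))
  have hfM := hfM M hM hA (hM.omegaSet_mem hwo hκ hne (h0'.trans_lt h0))
  intro x hx
  obtain ⟨y, hy⟩ := hf.total x hx
  obtain ⟨a, ha, rfl⟩ := mem_omegaSet.1 (hf.dom_cod _ _ hy).2
  rw [Nat.cast_zero, Ordinal.omega_zero] at ha
  obtain ⟨n, rfl⟩ := Ordinal.lt_omega0.1 ha
  exact hM.symm_apply_mem hwo hf hfM (hM.natCast_mem hwo hκ hne n) hy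

theorem countable_of_mem_omegaSet_one {x : ZFSet.{u}} (h : x ∈ omegaSet 1) :
    (x : Set ZFSet.{u}).Countable := by
  rw [countable_iff_card_le]
  simpa using card_le_of_mem_omegaSet_succ (l := 0) h

theorem subset_of_mem_height (hM : IsSub κ wo M) (hwo : IsWellOrder (H κ) wo)
    (hκ : κ.IsRegular) (h0 : ℵ₀ < κ) {x : ZFSet.{u}} (hx : x ∈ height M) : x ⊆ height M := by
  have hx' := ZFSet.mem_inter.1 hx
  intro y hy
  exact ZFSet.mem_inter.2 ⟨hM.subset_of_countable hwo hκ h0 hx'.1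
    (countable_of_mem_omegaSet_one hx'.2) hy,
    (ZFSet.isOrdinal_toZFSet _).mem_trans hy hx'.2⟩

/-- The height is the von Neumann version of an ordinal. -/
theorem exists_height_eq (hM : IsSub κ wo M) (hwo : IsWellOrder (H κ) wo)
    (hκ : κ.IsRegular) (h0 : ℵ₀ < κ) :
    ∃ d : Ordinal.{u}, ∀ a : Ordinal.{u}, a.toZFSet ∈ height M ↔ a < d := by
  let s : Set Ordinal.{u} := {a | a.toZFSet ∉ height M}
  have hs : s.Nonempty := ⟨Ordinal.omega ((1 : ℕ) : Ordinal.{u}), fun h =>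
    lt_irrefl _ (toZFSet_mem_omegaSet.1 (ZFSet.mem_inter.1 h).2)⟩
  refine ⟨sInf s, fun a => ⟨fun h => ?_, fun h => ?_⟩⟩
  · by_contra hle
    rcases (not_lt.1 hle).eq_or_lt with h1 | h1
    · exact csInf_mem hs (h1 ▸ h)
    · exact csInf_mem hs
        (hM.subset_of_mem_height hwo hκ h0 h (Ordinal.toZFSet_mem_toZFSet_iff.2 h1))
  · by_contra h'
    exact (csInf_le' (s := s) h').not_gt h

end IsSub

/-! ### Suprema, countable subsets of `ω₁`, order types -/

/-- The least strict upper bound of the ordinals that belong to `A`. -/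
noncomputable def ordSup (A : ZFSet.{u}) : Ordinal.{u} :=
  sInf {b | ∀ a : Ordinal.{u}, a.toZFSet ∈ A → a < b}

theorem lt_ordSup {A : ZFSet.{u}} {a : Ordinal.{u}} (h : a.toZFSet ∈ A) : a < ordSup A := by
  have hs : {b | ∀ a : Ordinal.{u}, a.toZFSet ∈ A → a < b}.Nonempty :=
    ⟨A.rank, fun a ha => by simpa using ZFSet.rank_lt_of_mem ha⟩
  exact csInf_mem hs a h

theorem ordSup_le {A : ZFSet.{u}} {b : Ordinal.{u}} (h : ∀ a : Ordinal.{u}, a.toZFSet ∈ A → a < b) :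
    ordSup A ≤ b :=
  csInf_le' h

theorem ordSup_mono {A B : ZFSet.{u}} (h : A ⊆ B) : ordSup A ≤ ordSup B :=
  ordSup_le fun _ ha => lt_ordSup (h ha)

theorem lt_ordSup_iff {A : ZFSet.{u}} {b : Ordinal.{u}} :
    b < ordSup A ↔ ∃ a : Ordinal.{u}, a.toZFSet ∈ A ∧ b ≤ a := by
  constructor
  · intro h
    by_contra! hc
    exact (ordSup_le fun a ha => hc a ha).not_gt h
  · rintro ⟨a, ha, hb⟩
    exact hb.trans_lt (lt_ordSup ha)

theorem ordSup_lt_omega {A : ZFSet.{u}} {l : ℕ} (h : IsCountableSubset (l + 1) A) :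
    ordSup A < Ordinal.omega ((l + 1 : ℕ) : Ordinal.{u}) := by
  let e : Shrink.{u} A → Ordinal.{u} := fun i => ZFSet.rank ((equivShrink A).symm i : A)
  have hreg : (ℵ_ ((l + 1 : ℕ) : Ordinal.{u})).IsRegular := by
    rw [Nat.cast_succ]
    exact isRegular_aleph_add_one _
  have h1 : ⨆ i, e i + 1 < Ordinal.omega ((l + 1 : ℕ) : Ordinal.{u}) := by
    refine Ordinal.iSup_add_one_lt_of_lt_cof ?_ fun i => ?_
    · rw [hreg.cof_omega_eq]
      refine ((countable_iff_card_le A).1 h.2).trans_lt ?_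
      rw [← aleph_zero, aleph_lt_aleph]
      simp
    · have := h.1 ((equivShrink A).symm i).2
      obtain ⟨a, ha, hax⟩ := mem_omegaSet.1 this
      simp only [e, ← hax, Ordinal.rank_toZFSet]
      exact ha
  refine (ordSup_le fun a ha => ?_).trans_lt h1
  have h2 : e (equivShrink A ⟨_, ha⟩) = a := by simp [e]
  have := Ordinal.le_iSup (fun i => e i + 1) (equivShrink A ⟨_, ha⟩)
  rw [h2] at this
  exact (Order.lt_add_one_iff.2 le_rfl).trans_le this

theorem IsSub.ordSup_inter_mem {M : ZFSet.{u}} (hM : IsSub κ wo M) (hwo : IsWellOrder (H κ) wo)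
    (hκ : κ.IsRegular) {l : ℕ} (hl : ℵ_ (l : Ordinal.{u}) < κ) {A B : ZFSet.{u}} (hA : A ∈ M)
    (hB : B ∈ M) (hAB : A ∩ B ⊆ omegaSet l) : (ordSup (A ∩ B)).toZFSet ∈ M := by
  have hle : ordSup (A ∩ B) ≤ Ordinal.omega (l : Ordinal.{u}) :=
    ordSup_le fun a ha => toZFSet_mem_omegaSet.1 (hAB ha)
  refine hM.mem_of_ext hwo (fun z a b _ => ∃ x : H κ, (x : ZFSet.{u}) ∈ (a : ZFSet.{u}) ∧
    (x : ZFSet.{u}) ∈ (b : ZFSet.{u}) ∧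
    ((z : ZFSet.{u}) ∈ (x : ZFSet.{u}) ∨ (z : ZFSet.{u}) = (x : ZFSet.{u})))
    (a := ⟨A, hM.subset A hA⟩) (b := ⟨B, hM.subset B hB⟩) (c := ⟨B, hM.subset B hB⟩)
    (mem_H_of_subset (omegaSet_mem_H hκ hl) (Ordinal.toZFSet_monotone hle)) (fun z => ?_) hA hB hB
  rw [Ordinal.mem_toZFSet_iff]
  constructor
  · rintro ⟨b, hb, hbz⟩
    obtain ⟨a, ha, hba⟩ := lt_ordSup_iff.1 hb
    have ha' := ZFSet.mem_inter.1 ha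
    refine ⟨⟨_, mem_H_of_mem (hM.subset A hA) ha'.1⟩, ha'.1, ha'.2, ?_⟩
    rw [← hbz]
    rcases hba.lt_or_eq with h | rfl
    · exact .inl (Ordinal.toZFSet_mem_toZFSet_iff.2 h)
    · exact .inr rfl
  · rintro ⟨⟨x, hxH⟩, hxA, hxB, hz⟩
    have hx := ZFSet.mem_inter.2 ⟨hxA, hxB⟩
    obtain ⟨a, -, rfl⟩ := mem_omegaSet.1 (hAB hx)
    rcases hz with h | h
    · obtain ⟨b, hb, hbz⟩ := Ordinal.mem_toZFSet_iff.1 h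
      exact ⟨b, hb.trans (lt_ordSup hx), hbz⟩
    · exact ⟨a, lt_ordSup hx, h.symm⟩

/-- Under `CH` a countable subset of `ω₁` in `M` belongs to every `L` that contains the height of
`M`: it is coded by a countable ordinal through the canonical injection of a power set
into `ω₁`. -/
theorem IsSub.mem_of_countable_subset_omega_one
    (CH : (2 : Cardinal.{u}) ^ Cardinal.aleph0.{u} = Cardinal.aleph 1)
    {M L : ZFSet.{u}} (hM : IsSub κ wo M) (hL : IsSub κ wo L) (hwo : IsWellOrder (H κ) wo)
    (hκ : κ.IsRegular) (h1 : ℵ_ ((1 : ℕ) : Ordinal.{u}) < κ) {A : ZFSet.{u}} (hA : A ∈ M)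
    (hAc : IsCountableSubset 1 A) (hML : height M ⊆ L) : A ∈ L := by
  have hβ : (ordSup A).toZFSet ∈ height M := by
    refine ZFSet.mem_inter.2 ⟨?_, toZFSet_mem_omegaSet.2 (ordSup_lt_omega hAc)⟩
    have h := hM.ordSup_inter_mem hwo hκ h1 hA hA (by simpa using hAc.1)
    rwa [ZFSet.inter_eq_left_of_subset subset_rfl] at h
  set β := (ordSup A).toZFSet
  have hβM := (ZFSet.mem_inter.1 hβ).1
  have hβL := hML hβ
  have hcard : β.powerset.card ≤ ℵ_ ((1 : ℕ) : Ordinal.{u}) := by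
    rw [ZFSet.card_powerset, Nat.cast_one, ← CH]
    exact power_le_power_left two_ne_zero ((countable_iff_card_le _).1
      (countable_of_mem_omegaSet_one (ZFSet.mem_inter.1 hβ).2))
  have hPH : β.powerset ∈ H κ := mem_H_of_forall_mem hκ (hcard.trans_lt h1) fun x hx =>
    mem_H_of_subset (hM.subset _ hβM) (ZFSet.mem_powerset.1 hx)
  obtain ⟨f, hf, hfM⟩ := exists_canonical_injection hκ hwo hPH (omegaSet_mem_H hκ h1)
    (hcard.trans_eq (card_omegaSet 1).symm)
  have hfm : ∀ K, IsSub κ wo K → β ∈ K → f ∈ K := fun K hK hβK =>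
    hfM K hK (hK.powerset_mem hwo hβK hPH) (hK.omegaSet_mem hwo hκ ⟨_, hβK⟩ h1)
  have hAβ : A ∈ β.powerset := ZFSet.mem_powerset.2 fun x hx => by
    obtain ⟨a, -, rfl⟩ := mem_omegaSet.1 (hAc.1 hx)
    exact Ordinal.toZFSet_mem_toZFSet_iff.2 (lt_ordSup hx)
  obtain ⟨y, hy⟩ := hf.total A hAβ
  have hyM : y ∈ height M :=
    ZFSet.mem_inter.2 ⟨hM.apply_mem hwo hf (hfm M hM hβM) hA hy, (hf.dom_cod _ _ hy).2⟩
  exact hL.symm_apply_mem hwo hf (hfm L hL hβL) (hML hyM) hy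

/-- `f` contains the graph of a strictly `∈`-increasing map from `A` to `θ`. -/
structure IsRankMap (f A θ : ZFSet.{u}) : Prop where
  total : ∀ x ∈ A, ∃ y ∈ θ, ZFSet.pair x y ∈ f
  mono : ∀ x x' y y', ZFSet.pair x y ∈ f → ZFSet.pair x' y' ∈ f → x ∈ x' → y ∈ y'

instance IsDefinable.isRankMap (i j k : ℕ) :
    IsDefinable κ wo (fun v => IsRankMap (v i : ZFSet.{u}) (v j) (v k)) :=
  congr (p := fun v => (∀ x : H κ, (x : ZFSet.{u}) ∈ (v j : ZFSet.{u}) →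
      ∃ y : H κ, (y : ZFSet.{u}) ∈ (v k : ZFSet.{u}) ∧ ZFSet.pair x y ∈ (v i : ZFSet.{u})) ∧
    (∀ x x' y y' : H κ, ZFSet.pair x y ∈ (v i : ZFSet.{u}) → ZFSet.pair x' y' ∈ (v i : ZFSet.{u}) →
      (x : ZFSet.{u}) ∈ (x' : ZFSet.{u}) → (y : ZFSet.{u}) ∈ (y' : ZFSet.{u})))
    inferInstance fun v => by
    have hP : ∀ {x y : ZFSet.{u}}, ZFSet.pair x y ∈ (v i : ZFSet.{u}) → x ∈ H κ ∧ y ∈ H κ :=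
      fun h => mem_H_of_pair_mem (v i).2 h
    constructor
    · rintro ⟨h1, h2⟩
      refine ⟨fun x hx => ?_, fun x x' y y' h h' => ?_⟩
      · obtain ⟨y, hy, hxy⟩ := h1 ⟨x, mem_H_of_mem (v j).2 hx⟩ hx
        exact ⟨y, hy, hxy⟩
      · exact h2 ⟨x, (hP h).1⟩ ⟨x', (hP h').1⟩ ⟨y, (hP h).2⟩ ⟨y', (hP h').2⟩ h h'
    · rintro ⟨h1, h2⟩
      refine ⟨fun x hx => ?_, fun x x' y y' h h' => h2 x x' y y' h h'⟩
      obtain ⟨y, hy, hxy⟩ := h1 x hx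
      exact ⟨⟨y, (hP hxy).2⟩, hy, hxy⟩

theorem exists_isRankMap (hκ : κ.IsRegular) (h1 : ℵ_ ((1 : ℕ) : Ordinal.{u}) < κ) {l : ℕ}
    {A : ZFSet.{u}} (hAH : A ∈ H κ) (hA : IsCountableSubset l A) :
    ∃ θ ∈ omegaSet.{u} 1, ∃ f ∈ H κ, IsRankMap f A θ := by
  let g : Shrink.{u} A → ZFSet.{u} := fun i => ((equivShrink A).symm i : A)
  have hgA : ∀ i, g i ∈ A := fun i => Subtype.prop _
  have hord : ∀ i, (g i).IsOrdinal := fun i => by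
    obtain ⟨a, -, h⟩ := mem_omegaSet.1 (hA.1 (hgA i))
    rw [← h]
    exact ZFSet.isOrdinal_toZFSet a
  have ginj : Function.Injective g := Subtype.val_injective.comp (equivShrink A).symm.injective
  let r : Shrink.{u} A → Shrink.{u} A → Prop := fun i j => g i ∈ g j
  let F : r ↪r ((· < ·) : Ordinal.{u} → Ordinal.{u} → Prop) :=
    ⟨⟨fun i => (g i).rank, fun i j h => ginj ((ZFSet.IsOrdinal.rank_inj (hord i) (hord j)).1 h)⟩,
      fun {i j} => ZFSet.IsOrdinal.rank_lt_iff_mem (hord i) (hord j)⟩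
  have : IsWellOrder (Shrink.{u} A) r := F.isWellOrder
  have hθ : Ordinal.type r < Ordinal.omega ((1 : ℕ) : Ordinal.{u}) := by
    rw [lt_omega_iff_card_lt, Ordinal.card_type]
    refine ((countable_iff_card_le A).1 hA.2).trans_lt ?_
    rw [← aleph_zero, aleph_lt_aleph]
    simp
  refine ⟨(Ordinal.type r).toZFSet, toZFSet_mem_omegaSet.2 hθ,
    ZFSet.range fun i => ZFSet.pair (g i) (Ordinal.typein r i).toZFSet,
    range_mem_H hκ (card_lt_of_mem_H hAH) fun i => pair_mem_H hκ (mem_H_of_mem hAH (hgA i)) ?_,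
    ?_, ?_⟩
  · exact mem_H_of_mem (omegaSet_mem_H hκ h1)
      (toZFSet_mem_omegaSet.2 ((Ordinal.typein_lt_type r i).trans hθ))
  · intro x hx
    refine ⟨(Ordinal.typein r (equivShrink A ⟨x, hx⟩)).toZFSet,
      Ordinal.toZFSet_mem_toZFSet_iff.2 (Ordinal.typein_lt_type r _),
      ZFSet.mem_range.2 ⟨equivShrink A ⟨x, hx⟩, ?_⟩⟩
    simp [g]
  · intro x x' y y' h h' hxx
    obtain ⟨i, hi⟩ := ZFSet.mem_range.1 h
    obtain ⟨rfl, rfl⟩ := ZFSet.pair_injective hi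
    obtain ⟨j, hj⟩ := ZFSet.mem_range.1 h'
    obtain ⟨rfl, rfl⟩ := ZFSet.pair_injective hj
    exact Ordinal.toZFSet_mem_toZFSet_iff.2 ((Ordinal.typein_lt_typein r).2 hxx)

/-- The order type of a countable set of ordinals in `M` is below the height of `M`. -/
theorem IsSub.exists_rank {M : ZFSet.{u}} (hM : IsSub κ wo M) (hwo : IsWellOrder (H κ) wo)
    (hκ : κ.IsRegular) (h1 : ℵ_ ((1 : ℕ) : Ordinal.{u}) < κ) {l : ℕ} {A : ZFSet.{u}} (hAM : A ∈ M)
    (hA : IsCountableSubset l A) :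
    ∃ θ : Ordinal.{u}, θ.toZFSet ∈ height M ∧ ∃ r : Ordinal.{u} → Ordinal.{u},
      (∀ a : Ordinal.{u}, a.toZFSet ∈ A → r a < θ) ∧
      ∀ a b : Ordinal.{u}, a.toZFSet ∈ A → b.toZFSet ∈ A → a < b → r a < r b := by
  have hAH := hM.subset A hAM
  have hωH := omegaSet_mem_H hκ h1
  obtain ⟨θ, hθ, f, hfH, hf⟩ := exists_isRankMap hκ h1 hAH hA
  obtain ⟨⟨θ', hθ'H⟩, ⟨hθ', ⟨f', hf'H⟩, hf'⟩, hθ'M⟩ := exists_canonical hwo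
    (fun θ A ω _ => (θ : ZFSet.{u}) ∈ (ω : ZFSet.{u}) ∧
      ∃ f : H κ, IsRankMap (f : ZFSet.{u}) A θ) ⟨A, hAH⟩ ⟨_, hωH⟩ ⟨_, hωH⟩
    ⟨⟨θ, mem_H_of_mem hωH hθ⟩, hθ, ⟨f, hfH⟩, hf⟩
  have hωM := hM.omegaSet_mem hwo hκ ⟨_, hAM⟩ h1
  have hθ'M := hθ'M M hM hAM hωM hωM
  change IsRankMap f' A θ' at hf'
  obtain ⟨t, ht, rfl⟩ := mem_omegaSet.1 hθ'
  have key : ∀ a : Ordinal.{u}, ∃ b : Ordinal.{u}, a.toZFSet ∈ A →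
      b < t ∧ ZFSet.pair a.toZFSet b.toZFSet ∈ f' := by
    intro a
    by_cases ha : a.toZFSet ∈ A
    · obtain ⟨y, hy, hay⟩ := hf'.total _ ha
      obtain ⟨b, hb, rfl⟩ := Ordinal.mem_toZFSet_iff.1 hy
      exact ⟨b, fun _ => ⟨hb, hay⟩⟩
    · exact ⟨0, fun h => absurd h ha⟩
  choose r hr using key
  refine ⟨t, ZFSet.mem_inter.2 ⟨hθ'M, hθ'⟩, r, fun a ha => (hr a ha).1, fun a b ha hb hab => ?_⟩
  exact Ordinal.toZFSet_mem_toZFSet_iff.1 (hf'.mono _ _ _ _ (hr a ha).2 (hr b hb).2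
    (Ordinal.toZFSet_mem_toZFSet_iff.2 hab))

/-! ### Coding pairs of countable ordinals and the counting argument -/

/-- `f` contains the graph of a map from `a × b` to `c` that is strictly increasing with respect to
the product order on `a × b` (for ordinals `a`, `b`). -/
structure IsPairing (f a b c : ZFSet.{u}) : Prop where
  total : ∀ x ∈ a, ∀ y ∈ b, ∃ z ∈ c, ZFSet.pair (ZFSet.pair x y) z ∈ f
  mono : ∀ x y z x' y' z', ZFSet.pair (ZFSet.pair x y) z ∈ f →
    ZFSet.pair (ZFSet.pair x' y') z' ∈ f → x ⊆ x' → y ⊆ y' → ¬ (x = x' ∧ y = y') → z ∈ z'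

instance IsDefinable.isPairing (i j k l : ℕ) :
    IsDefinable κ wo (fun v => IsPairing (v i : ZFSet.{u}) (v j) (v k) (v l)) :=
  congr (p := fun v => (∀ x : H κ, (x : ZFSet.{u}) ∈ (v j : ZFSet.{u}) →
      ∀ y : H κ, (y : ZFSet.{u}) ∈ (v k : ZFSet.{u}) →
      ∃ z : H κ, (z : ZFSet.{u}) ∈ (v l : ZFSet.{u}) ∧
        ZFSet.pair (ZFSet.pair x y) z ∈ (v i : ZFSet.{u})) ∧
    (∀ x y z x' y' z' : H κ, ZFSet.pair (ZFSet.pair x y) z ∈ (v i : ZFSet.{u}) →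
      ZFSet.pair (ZFSet.pair x' y') z' ∈ (v i : ZFSet.{u}) →
      (x : ZFSet.{u}) ⊆ (x' : ZFSet.{u}) → (y : ZFSet.{u}) ⊆ (y' : ZFSet.{u}) →
      ¬ ((x : ZFSet.{u}) = (x' : ZFSet.{u}) ∧ (y : ZFSet.{u}) = (y' : ZFSet.{u})) →
      (z : ZFSet.{u}) ∈ (z' : ZFSet.{u})))
    inferInstance fun v => by
    have hQ : ∀ {x y z : ZFSet.{u}}, ZFSet.pair (ZFSet.pair x y) z ∈ (v i : ZFSet.{u}) →
        x ∈ H κ ∧ y ∈ H κ ∧ z ∈ H κ := fun {x y z} h => by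
      have h1 := mem_H_of_pair_mem (v i).2 h
      have h2 : ({x, y} : ZFSet.{u}) ∈ H κ := mem_H_of_mem h1.1 (ZFSet.mem_pair.2 (.inr rfl))
      exact ⟨mem_H_of_mem h2 (ZFSet.mem_pair.2 (.inl rfl)),
        mem_H_of_mem h2 (ZFSet.mem_pair.2 (.inr rfl)), h1.2⟩
    constructor
    · rintro ⟨h1, h2⟩
      refine ⟨fun x hx y hy => ?_, fun x y z x' y' z' h h' => ?_⟩
      · obtain ⟨z, hz, hxyz⟩ := h1 ⟨x, mem_H_of_mem (v j).2 hx⟩ hx ⟨y, mem_H_of_mem (v k).2 hy⟩ hy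
        exact ⟨z, hz, hxyz⟩
      · exact h2 ⟨x, (hQ h).1⟩ ⟨y, (hQ h).2.1⟩ ⟨z, (hQ h).2.2⟩ ⟨x', (hQ h').1⟩ ⟨y', (hQ h').2.1⟩
          ⟨z', (hQ h').2.2⟩ h h'
    · rintro ⟨h1, h2⟩
      refine ⟨fun x hx y hy => ?_, fun x y z x' y' z' h h' => h2 x y z x' y' z' h h'⟩
      obtain ⟨z, hz, hxyz⟩ := h1 x hx y hy
      exact ⟨⟨z, (hQ hxyz).2.2⟩, hz, hxyz⟩

theorem mul_add_lt_mul_add {b x x' y y' : Ordinal.{u}} (hy : y < b) (hx : x ≤ x') (hyy : y ≤ y')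
    (hne : ¬ (x = x' ∧ y = y')) : b * x + y < b * x' + y' := by
  rcases hx.lt_or_eq with h | rfl
  · calc b * x + y < b * x + b := by gcongr
      _ = b * (x + 1) := by rw [mul_add, mul_one]
      _ ≤ b * x' := by gcongr; exact Order.add_one_le_of_lt h
      _ ≤ b * x' + y' := le_self_add
  · have : y < y' := hyy.lt_of_ne fun h => hne ⟨rfl, h⟩
    gcongr

/-- The map `(x, y) ↦ b * x + y` codes pairs. -/
theorem exists_isPairing (hκ : κ.IsRegular) (h1 : ℵ_ ((1 : ℕ) : Ordinal.{u}) < κ)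
    {a b : Ordinal.{u}} (ha : a < Ordinal.omega ((1 : ℕ) : Ordinal.{u}))
    (hb : b < Ordinal.omega ((1 : ℕ) : Ordinal.{u})) :
    ∃ c ∈ omegaSet.{u} 1, ∃ f ∈ H κ, IsPairing f a.toZFSet b.toZFSet c := by
  have hωH := omegaSet_mem_H hκ h1
  have hcard : ∀ {c : Ordinal.{u}}, c < Ordinal.omega ((1 : ℕ) : Ordinal.{u}) ↔ c.card ≤ ℵ₀ := by
    intro c
    rw [lt_omega_iff_card_lt, Nat.cast_one, ← succ_aleph0, Order.lt_succ_iff]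
  have hc : b * a < Ordinal.omega ((1 : ℕ) : Ordinal.{u}) := by
    rw [hcard, Ordinal.card_mul]
    exact (mul_le_mul' (hcard.1 hb) (hcard.1 ha)).trans_eq aleph0_mul_aleph0
  have hlt : ∀ {x y : Ordinal.{u}}, x < a → y < b → b * x + y < b * a := fun {x y} hx hy => by
    have := mul_add_lt_mul_add (y' := y) hy hx.le le_rfl fun h => hx.ne h.1
    calc b * x + y < b * x + b := by gcongr
      _ = b * (x + 1) := by rw [mul_add, mul_one]
      _ ≤ b * a := by gcongr; exact Order.add_one_le_of_lt hx
  let A := a.toZFSet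
  let B := b.toZFSet
  let g : Shrink.{u} A → ZFSet.{u} := fun i => ((equivShrink A).symm i : A)
  let g' : Shrink.{u} B → ZFSet.{u} := fun i => ((equivShrink B).symm i : B)
  have hgA : ∀ i, ∃ x < a, x.toZFSet = g i := fun i => Ordinal.mem_toZFSet_iff.1 (Subtype.prop _)
  have hgB : ∀ i, ∃ y < b, y.toZFSet = g' i := fun i => Ordinal.mem_toZFSet_iff.1 (Subtype.prop _)
  choose o ho hog using hgA
  choose o' ho' hog' using hgB
  let f := ZFSet.range fun p : Shrink.{u} A × Shrink.{u} B =>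
    ZFSet.pair (ZFSet.pair (o p.1).toZFSet (o' p.2).toZFSet) (b * o p.1 + o' p.2).toZFSet
  have hωmem : ∀ {c : Ordinal.{u}}, c < Ordinal.omega ((1 : ℕ) : Ordinal.{u}) → c.toZFSet ∈ H κ :=
    fun h => mem_H_of_mem hωH (toZFSet_mem_omegaSet.2 h)
  have hm : ∀ {x y z : ZFSet.{u}}, ZFSet.pair (ZFSet.pair x y) z ∈ f → ∃ s < a, ∃ t < b,
      x = s.toZFSet ∧ y = t.toZFSet ∧ z = (b * s + t).toZFSet := by
    intro x y z h
    obtain ⟨p, hp⟩ := ZFSet.mem_range.1 h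
    obtain ⟨h2, rfl⟩ := ZFSet.pair_injective hp
    obtain ⟨rfl, rfl⟩ := ZFSet.pair_injective h2
    exact ⟨_, ho _, _, ho' _, rfl, rfl, rfl⟩
  refine ⟨(b * a).toZFSet, toZFSet_mem_omegaSet.2 hc, f, range_mem_H hκ ?_ fun p =>
    pair_mem_H hκ (pair_mem_H hκ (hωmem ((ho _).trans ha)) (hωmem ((ho' _).trans hb)))
      (hωmem ((hlt (ho _) (ho' _)).trans hc)), ?_, ?_⟩
  · rw [mk_prod, lift_id, lift_id]
    exact mul_lt_of_lt hκ.aleph0_le (card_lt_of_mem_H (hωmem ha)) (card_lt_of_mem_H (hωmem hb))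
  · intro x hx y hy
    refine ⟨_, Ordinal.toZFSet_mem_toZFSet_iff.2 (hlt (ho (equivShrink A ⟨x, hx⟩))
      (ho' (equivShrink B ⟨y, hy⟩))), ZFSet.mem_range.2 ⟨(equivShrink A ⟨x, hx⟩,
      equivShrink B ⟨y, hy⟩), ?_⟩⟩
    simp only [hog, hog']
    simp [g, g']
  · intro x y z x' y' z' h h' hx hy hne
    obtain ⟨s, hs, t, ht, rfl, rfl, rfl⟩ := hm h
    obtain ⟨s', hs', t', ht', rfl, rfl, rfl⟩ := hm h'
    refine Ordinal.toZFSet_mem_toZFSet_iff.2 (mul_add_lt_mul_add ht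
      (Ordinal.toZFSet_subset_toZFSet_iff.1 hx) (Ordinal.toZFSet_subset_toZFSet_iff.1 hy) ?_)
    rintro ⟨rfl, rfl⟩
    exact hne ⟨rfl, rfl⟩

/-- `d` is closed under some way of coding pairs that is strictly increasing for the product
order. -/
def IsPairingClosed (d : Ordinal.{u}) : Prop :=
  ∀ a < d, ∀ b < d, ∃ c < d, ∃ h : Ordinal.{u} → Ordinal.{u} → Ordinal.{u},
    (∀ x < a, ∀ y < b, h x y < c) ∧
    ∀ x y x' y', x' < a → y' < b → x ≤ x' → y ≤ y' → ¬ (x = x' ∧ y = y') → h x y < h x' y'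

theorem IsSub.isPairingClosed {M : ZFSet.{u}} (hM : IsSub κ wo M) (hwo : IsWellOrder (H κ) wo)
    (hκ : κ.IsRegular) (h1 : ℵ_ ((1 : ℕ) : Ordinal.{u}) < κ) {d : Ordinal.{u}}
    (hd : ∀ a : Ordinal.{u}, a.toZFSet ∈ height M ↔ a < d) : IsPairingClosed d := by
  intro a ha b hb
  have ha' := ZFSet.mem_inter.1 ((hd a).2 ha)
  have hb' := ZFSet.mem_inter.1 ((hd b).2 hb)
  have hωH := omegaSet_mem_H hκ h1
  have hωM := hM.omegaSet_mem hwo hκ ⟨_, ha'.1⟩ h1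
  obtain ⟨c, hc, f, hfH, hf⟩ := exists_isPairing hκ h1 (toZFSet_mem_omegaSet.1 ha'.2)
    (toZFSet_mem_omegaSet.1 hb'.2)
  obtain ⟨⟨c', hc'H⟩, ⟨hc', ⟨f', hf'H⟩, hf'⟩, hc'M⟩ := exists_canonical hwo
    (fun c a b ω => (c : ZFSet.{u}) ∈ (ω : ZFSet.{u}) ∧
      ∃ f : H κ, IsPairing (f : ZFSet.{u}) a b c) ⟨_, hM.subset _ ha'.1⟩ ⟨_, hM.subset _ hb'.1⟩
    ⟨_, hωH⟩ ⟨⟨c, mem_H_of_mem hωH hc⟩, hc, ⟨f, hfH⟩, hf⟩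
  have hc'M := hc'M M hM ha'.1 hb'.1 hωM
  change IsPairing f' a.toZFSet b.toZFSet c' at hf'
  obtain ⟨t, ht, rfl⟩ := mem_omegaSet.1 hc'
  have key : ∀ x y : Ordinal.{u}, ∃ z : Ordinal.{u}, x < a → y < b →
      z < t ∧ ZFSet.pair (ZFSet.pair x.toZFSet y.toZFSet) z.toZFSet ∈ f' := by
    intro x y
    by_cases hxy : x < a ∧ y < b
    · obtain ⟨z, hz, hxyz⟩ := hf'.total _ (Ordinal.toZFSet_mem_toZFSet_iff.2 hxy.1) _
        (Ordinal.toZFSet_mem_toZFSet_iff.2 hxy.2)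
      obtain ⟨z, hzt, rfl⟩ := Ordinal.mem_toZFSet_iff.1 hz
      exact ⟨z, fun _ _ => ⟨hzt, hxyz⟩⟩
    · exact ⟨0, fun h h' => absurd ⟨h, h'⟩ hxy⟩
  choose h hh using key
  refine ⟨t, (hd t).1 (ZFSet.mem_inter.2 ⟨hc'M, hc'⟩), h, fun x hx y hy => (hh x y hx hy).1, ?_⟩
  intro x y x' y' hx' hy' hx hy hne
  refine Ordinal.toZFSet_mem_toZFSet_iff.1 (hf'.mono _ _ _ _ _ _
    (hh x y (hx.trans_lt hx') (hy.trans_lt hy')).2 (hh x' y' hx' hy').2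
    (Ordinal.toZFSet_monotone hx) (Ordinal.toZFSet_monotone hy) fun h => hne ?_)
  exact ⟨Ordinal.toZFSet_injective h.1, Ordinal.toZFSet_injective h.2⟩

/-- Finitely many increasing functions bounded below `d` are coded by a single one: a step on which
the code does not change is a step on which none of them changes. -/
theorem IsPairingClosed.exists_combination {d : Ordinal.{u}} (hd : IsPairingClosed d)
    {ι : Type*} [Finite ι] (g : ι → Ordinal.{u} → Ordinal.{u})
    (hbdd : ∀ i, ∃ θ < d, ∀ α < d, g i α < θ)
    (hmono : ∀ i α β, α ≤ β → β < d → g i α ≤ g i β) (h0 : 1 < d) :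
    ∃ G : Ordinal.{u} → Ordinal.{u}, (∃ θ < d, ∀ α < d, G α < θ) ∧
      (∀ α β, α ≤ β → β < d → G α ≤ G β) ∧
      ∀ α β, α ≤ β → β < d → G α = G β → ∀ i, g i α = g i β := by
  classical
  cases nonempty_fintype ι
  suffices h : ∀ s : Finset ι, ∃ G : Ordinal.{u} → Ordinal.{u}, (∃ θ < d, ∀ α < d, G α < θ) ∧
      (∀ α β, α ≤ β → β < d → G α ≤ G β) ∧
      ∀ α β, α ≤ β → β < d → G α = G β → ∀ i ∈ s, g i α = g i β by
    obtain ⟨G, h1, h2, h3⟩ := h Finset.univ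
    exact ⟨G, h1, h2, fun α β h h' h'' i => h3 α β h h' h'' i (Finset.mem_univ i)⟩
  intro s
  induction s using Finset.induction_on with
  | empty => exact ⟨fun _ => 0, ⟨1, h0, fun _ _ => zero_lt_one⟩, by simp, by simp⟩
  | insert j s _ ih =>
    obtain ⟨G, ⟨θ, hθ, hGθ⟩, hG, hGs⟩ := ih
    obtain ⟨η, hη, hgη⟩ := hbdd j
    obtain ⟨c, hc, h, hhc, hh⟩ := hd θ hθ η hη
    refine ⟨fun α => h (G α) (g j α), ⟨c, hc, fun α hα => hhc _ (hGθ α hα) _ (hgη α hα)⟩, ?_, ?_⟩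
    · intro α β hαβ hβ
      by_cases heq : G α = G β ∧ g j α = g j β
      · simp only [heq.1, heq.2, le_refl]
      · exact (hh _ _ _ _ (hGθ β hβ) (hgη β hβ) (hG α β hαβ hβ) (hmono j α β hαβ hβ) heq).le
    · intro α β hαβ hβ heq
      have : G α = G β ∧ g j α = g j β := by
        by_contra hne
        exact (hh _ _ _ _ (hGθ β hβ) (hgη β hβ) (hG α β hαβ hβ) (hmono j α β hαβ hβ) hne).ne heq
      intro i hi
      rcases Finset.mem_insert.1 hi with rfl | hi
      · exact this.2
      · exact hGs α β hαβ hβ this.1 i hi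

/-- Finitely many increasing functions on `d`, each bounded below `d`, are simultaneously constant
on some step `[α, α + 1]`: otherwise one function coding all of them would be strictly increasing,
hence unbounded in `d`. -/
theorem IsPairingClosed.exists_constant_step {d : Ordinal.{u}} (hd : IsPairingClosed d)
    (hlim : ∀ a < d, a + 1 < d) {ι : Type*} [Finite ι] (g : ι → Ordinal.{u} → Ordinal.{u})
    (hbdd : ∀ i, ∃ θ < d, ∀ α < d, g i α < θ)
    (hmono : ∀ i α β, α ≤ β → β < d → g i α ≤ g i β) {α₀ : Ordinal.{u}} (hα₀ : α₀ < d) :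
    ∃ α, α₀ ≤ α ∧ α < d ∧ ∀ i, g i α = g i (α + 1) := by
  have h1 : 1 < d := by simpa using hlim 0 (bot_le.trans_lt hα₀)
  -- The extra function `α ↦ min α α₀` forces the constant step to lie above `α₀`.
  let g' : Option ι → Ordinal.{u} → Ordinal.{u} := fun o α => o.elim (min α α₀) fun i => g i α
  obtain ⟨G, ⟨θ, hθ, hGθ⟩, hG, hGg⟩ := hd.exists_combination g'
    (by
      rintro (_ | i)
      · exact ⟨α₀ + 1, hlim _ hα₀, fun α _ => Order.lt_add_one_iff.2 (min_le_right _ _)⟩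
      · exact hbdd i)
    (by
      rintro (_ | i) α β h h'
      · exact min_le_min_right _ h
      · exact hmono i α β h h') h1
  have hstep : ∃ α < d, G α = G (α + 1) := by
    by_contra! hne
    have hle : ∀ α, α < d → α ≤ G α := by
      intro α
      induction α using WellFoundedLT.induction with
      | ind α ih =>
        intro hα
        refine le_of_forall_lt fun β hβ => ?_
        calc β ≤ G β := ih β hβ (hβ.trans hα)
          _ < G (β + 1) := (hG _ _ le_self_add (hlim β (hβ.trans hα))).lt_of_ne
            (hne β (hβ.trans hα))
          _ ≤ G α := hG _ _ (Order.add_one_le_of_lt hβ) hα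
    exact ((hle θ hθ).trans_lt (hGθ θ hθ)).false
  obtain ⟨α, hα, heq⟩ := hstep
  have hg := hGg _ _ le_self_add (hlim α hα) heq
  refine ⟨α, ?_, hα, fun i => hg (some i)⟩
  by_contra! hlt
  have h2 : min α α₀ = min (α + 1) α₀ := hg none
  rw [min_eq_left hlt.le, min_eq_left (Order.add_one_le_of_lt hlt)] at h2
  exact (Order.lt_add_one_iff.2 le_rfl).ne h2

/-! ### Traces on a submodel of `N` -/

theorem IsModel.isSub {k : ℕ} {N : ZFSet.{u}} (h : IsModel κ wo k N) : IsSub κ wo N := by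
  cases k with
  | zero => exact h
  | succ k => exact h.1

/-- The supremum of an arbitrary part of a countable `A ∈ M` lies in `M`: it is the supremum of
all of `A` or of a proper initial segment of `A`, and elements of `A` lie in `M`. -/
theorem IsSub.ordSup_mem_of_countable {M : ZFSet.{u}} (hM : IsSub κ wo M)
    (hwo : IsWellOrder (H κ) wo) (hκ : κ.IsRegular) (h0 : ℵ₀ < κ) {l : ℕ}
    (hl : ℵ_ (l : Ordinal.{u}) < κ) {A : ZFSet.{u}} (hAM : A ∈ M) (hA : IsCountableSubset l A)
    (B : ZFSet.{u}) : (ordSup (A ∩ B)).toZFSet ∈ M := by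
  set ξ := ordSup (A ∩ B)
  by_cases hall : ∀ a : Ordinal.{u}, a.toZFSet ∈ A → a < ξ
  · have h : ordSup (A ∩ A) = ξ := by
      rw [ZFSet.inter_eq_left_of_subset subset_rfl]
      exact le_antisymm (ordSup_le hall) (ordSup_mono fun _ h => (ZFSet.mem_inter.1 h).1)
    rw [← h]
    exact hM.ordSup_inter_mem hwo hκ hl hAM hAM fun _ h => hA.1 (ZFSet.mem_inter.1 h).1
  · push Not at hall
    let s : Set Ordinal.{u} := {a | a.toZFSet ∈ A ∧ ξ ≤ a}
    have hs : s.Nonempty := hall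
    have hρ : sInf s ∈ s := csInf_mem hs
    have h : ordSup (A ∩ (sInf s).toZFSet) = ξ := by
      apply le_antisymm
      · refine ordSup_le fun a ha => ?_
        by_contra hlt
        exact (csInf_le' (show a ∈ s from ⟨(ZFSet.mem_inter.1 ha).1, not_lt.1 hlt⟩)).not_gt
          (Ordinal.toZFSet_mem_toZFSet_iff.1 (ZFSet.mem_inter.1 ha).2)
      · refine ordSup_le fun a ha => lt_ordSup (ZFSet.mem_inter.2 ⟨(ZFSet.mem_inter.1 ha).1, ?_⟩)
        exact Ordinal.toZFSet_mem_toZFSet_iff.2 ((lt_ordSup ha).trans_le hρ.2)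
    rw [← h]
    exact hM.ordSup_inter_mem hwo hκ hl hAM
      (hM.subset_of_countable hwo hκ h0 hAM hA.2 hρ.1) fun _ h => hA.1 (ZFSet.mem_inter.1 h).1

/-- If `C ∈ K` then `sup (A ∩ C)` lies in `K`, whatever `A` is: it is the supremum of the ordinals
of `C` below the least ordinal of `C` that is not below it. -/
theorem IsSub.ordSup_inter_mem_of_mem {C K : ZFSet.{u}} (hC : IsSub κ wo C) (hK : IsSub κ wo K)
    (hwo : IsWellOrder (H κ) wo) (hκ : κ.IsRegular) {l : ℕ} (hl : ℵ_ (l : Ordinal.{u}) < κ)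
    (hCK : C ∈ K) (hCsub : C ⊆ K) (hne : C.Nonempty) {A : ZFSet.{u}} (hA : A ⊆ omegaSet l) :
    (ordSup (A ∩ C)).toZFSet ∈ K := by
  set ξ := ordSup (A ∩ C)
  let s : Set Ordinal.{u} := {a | a.toZFSet ∈ C ∧ ξ ≤ a}
  have hω : Ordinal.omega (l : Ordinal.{u}) ∈ s := ⟨hC.omegaSet_mem hwo hκ hne hl,
    ordSup_le fun a ha => toZFSet_mem_omegaSet.1 (hA (ZFSet.mem_inter.1 ha).1)⟩
  have hη : sInf s ∈ s := csInf_mem ⟨_, hω⟩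
  have h : ordSup (C ∩ (sInf s).toZFSet) = ξ := by
    apply le_antisymm
    · refine ordSup_le fun a ha => ?_
      by_contra hlt
      exact (csInf_le' (show a ∈ s from ⟨(ZFSet.mem_inter.1 ha).1, not_lt.1 hlt⟩)).not_gt
        (Ordinal.toZFSet_mem_toZFSet_iff.1 (ZFSet.mem_inter.1 ha).2)
    · refine ordSup_le fun a ha => lt_ordSup (ZFSet.mem_inter.2 ⟨(ZFSet.mem_inter.1 ha).2, ?_⟩)
      exact Ordinal.toZFSet_mem_toZFSet_iff.2 ((lt_ordSup ha).trans_le hη.2)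
  rw [← h]
  exact hK.ordSup_inter_mem hwo hκ hl hCK (hCsub hη.1) fun x hx =>
    Ordinal.toZFSet_monotone (csInf_le' hω) (ZFSet.mem_inter.1 hx).2

/-- If the suprema of the images of `A ∩ B` and `A ∩ B'` under a strictly increasing map agree, so
do the suprema of `A ∩ B ⊆ A ∩ B'` themselves. -/
theorem ordSup_inter_eq_of_rank {A B B' : ZFSet.{u}} (hBB : B ⊆ B') {r : Ordinal.{u} → Ordinal.{u}}
    {θ : Ordinal.{u}} (hrθ : ∀ a : Ordinal.{u}, a.toZFSet ∈ A → r a < θ)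
    (hr : ∀ a b : Ordinal.{u}, a.toZFSet ∈ A → b.toZFSet ∈ A → a < b → r a < r b)
    (heq : sInf {b | ∀ a : Ordinal.{u}, a.toZFSet ∈ A ∩ B → r a < b} =
      sInf {b | ∀ a : Ordinal.{u}, a.toZFSet ∈ A ∩ B' → r a < b}) :
    ordSup (A ∩ B) = ordSup (A ∩ B') := by
  refine le_antisymm (ordSup_mono fun x hx => ZFSet.mem_inter.2
    ⟨(ZFSet.mem_inter.1 hx).1, hBB (ZFSet.mem_inter.1 hx).2⟩) ?_
  by_contra hlt
  obtain ⟨a, ha, hle⟩ := lt_ordSup_iff.1 (not_le.1 hlt)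
  have hne : {b | ∀ a : Ordinal.{u}, a.toZFSet ∈ A ∩ B' → r a < b}.Nonempty :=
    ⟨θ, fun a ha => hrθ a (ZFSet.mem_inter.1 ha).1⟩
  have h1 : r a < sInf {b | ∀ a : Ordinal.{u}, a.toZFSet ∈ A ∩ B' → r a < b} := csInf_mem hne a ha
  rw [← heq] at h1
  refine h1.not_ge (csInf_le' fun b hb => ?_)
  exact hr b a (ZFSet.mem_inter.1 hb).1 (ZFSet.mem_inter.1 ha).1 ((lt_ordSup hb).trans_le hle)

theorem IsCountableSubset.image {f a A : ZFSet.{u}} {l m : ℕ} (hf : IsInjection f a (omegaSet m))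
    (hA : IsCountableSubset l A) :
    IsCountableSubset m ((omegaSet m).sep fun y => ∃ z ∈ A, ZFSet.pair z y ∈ f) := by
  refine ⟨ZFSet.sep_subset, ?_⟩
  have hch : ∀ z : ZFSet.{u}, ∃ y, ∀ y', ZFSet.pair z y' ∈ f → y' = y := by
    intro z
    by_cases h : ∃ y, ZFSet.pair z y ∈ f
    · obtain ⟨y, hy⟩ := h
      exact ⟨y, fun y' hy' => hf.functional _ _ _ hy' hy⟩
    · exact ⟨∅, fun y' hy' => absurd ⟨y', hy'⟩ h⟩
  choose F hF using hch
  refine (hA.2.image F).mono ?_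
  intro y hy
  obtain ⟨-, z, hz, hzy⟩ := ZFSet.mem_sep.1 hy
  exact ⟨z, hz, (hF z y hzy).symm⟩

/-- The trace of `A` on `L` can be pulled back through an injection `f` that lies in `L`, provided
`A ∩ L` is contained in the domain of `f`. -/
theorem inter_eq_preimage {L f a A : ZFSet.{u}} {m : ℕ} (hL : IsSub κ wo L)
    (hwo : IsWellOrder (H κ) wo) (hf : IsInjection f a (omegaSet m)) (hfL : f ∈ L)
    (hAL : A ∩ L ⊆ a) :
    A ∩ L = a.sep fun x => ∃ y ∈ ((omegaSet m).sep fun y => ∃ z ∈ A ∩ a, ZFSet.pair z y ∈ f) ∩ L,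
      ZFSet.pair x y ∈ f := by
  ext x
  rw [ZFSet.mem_sep]
  constructor
  · intro hx
    have hxa := hAL hx
    rw [ZFSet.mem_inter] at hx
    obtain ⟨y, hy⟩ := hf.total x hxa
    refine ⟨hxa, y, ZFSet.mem_inter.2 ⟨ZFSet.mem_sep.2 ⟨(hf.dom_cod _ _ hy).2, x,
      ZFSet.mem_inter.2 ⟨hx.1, hxa⟩, hy⟩, hL.apply_mem hwo hf hfL hx.2 hy⟩, hy⟩
  · rintro ⟨-, y, hy, hxy⟩
    rw [ZFSet.mem_inter, ZFSet.mem_sep] at hy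
    obtain ⟨⟨-, z, hz, hzy⟩, hyL⟩ := hy
    obtain rfl := hf.injective _ _ _ hxy hzy
    exact ZFSet.mem_inter.2 ⟨(ZFSet.mem_inter.1 hz).1, hL.symm_apply_mem hwo hf hfL hyL hxy⟩

theorem exists_mem_chain_of_finite {d : Ordinal.{u}} (hd : 0 < d) {C : Ordinal.{u} → ZFSet.{u}}
    (hC : ∀ α β, α ≤ β → β < d → C α ⊆ C β) {T : Set ZFSet.{u}} (hT : T.Finite)
    (h : ∀ x ∈ T, ∃ α < d, x ∈ C α) : ∃ α < d, ∀ x ∈ T, x ∈ C α := by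
  induction T, hT using Set.Finite.induction_on with
  | empty => exact ⟨0, hd, by simp⟩
  | @insert a s _ _ ih =>
    obtain ⟨α, hα, hs⟩ := ih fun x hx => h x (Set.mem_insert_of_mem _ hx)
    obtain ⟨β, hβ, ha⟩ := h a (Set.mem_insert _ _)
    refine ⟨max α β, max_lt hα hβ, ?_⟩
    rintro x (rfl | hx)
    · exact hC _ _ (le_max_right _ _) (max_lt hα hβ) ha
    · exact hC _ _ (le_max_left _ _) (max_lt hα hβ) (hs x hx)

/-- The chain witnessing that `N` is a `(k + 1)`-model, indexed by the ordinals below an ordinal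
`d` of which `height N` is the von Neumann version. -/
theorem IsModel.exists_chain (hwo : IsWellOrder (H κ) wo) (hκ : κ.IsRegular) (h0 : ℵ₀ < κ) {k : ℕ}
    {N : ZFSet.{u}} (hN : IsModel κ wo (k + 1) N) :
    ∃ (d : Ordinal.{u}) (C : Ordinal.{u} → ZFSet.{u}),
      (∀ a : Ordinal.{u}, a.toZFSet ∈ height N ↔ a < d) ∧
      (∀ α < d, C α ∈ N ∧ IsModel κ wo k (C α)) ∧ (∀ α β, α < β → β < d → C α ∈ C β) ∧
      (∀ α β, α ≤ β → β < d → C α ⊆ C β) ∧ ∀ x, x ∈ N ↔ ∃ α < d, x ∈ C α := by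
  obtain ⟨hNs, C, hC1, hC2, -, hC4⟩ := hN
  obtain ⟨d, hd⟩ := hNs.exists_height_eq hwo hκ h0
  simp only [hd] at hC1 hC2 hC4
  refine ⟨d, C, hd, hC1, fun α β h h' => hC2 α β h' h, fun α β h h' => ?_, hC4⟩
  rcases h.lt_or_eq with hlt | rfl
  · exact (hC1 β h').2.isSub.subset_of_countable hwo hκ h0 (hC2 α β h' hlt)
      (hC1 α (hlt.trans h')).2.isSub.countable
  · exact subset_rfl

theorem IsSub.add_one_lt_height {N : ZFSet.{u}} (hN : IsSub κ wo N)
    (hwo : IsWellOrder (H κ) wo) (hκ : κ.IsRegular) {d : Ordinal.{u}}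
    (hd : ∀ a : Ordinal.{u}, a.toZFSet ∈ height N ↔ a < d) {a : Ordinal.{u}} (ha : a < d) :
    a + 1 < d := by
  have h := ZFSet.mem_inter.1 ((hd a).2 ha)
  refine (hd _).1 (ZFSet.mem_inter.2 ⟨?_, ?_⟩)
  · rw [Ordinal.toZFSet_add_one]
    exact hN.insert_mem hwo hκ h.1 h.1
  · exact toZFSet_mem_omegaSet.2 ((isSuccLimit_omega _).add_one_lt (toZFSet_mem_omegaSet.1 h.2))

/-- For finitely many countable sets `A i ∈ M i` of ordinals below `ω_(k+1)`, a `k`-model `N` of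
larger height is, or contains, a model `L` on which all the traces `A i ∩ L` are known to `M i` and
to `L`. The alternative `L = N` is needed only for `k = 0`. -/
theorem exists_model_inter_mem
    (CH : (2 : Cardinal.{u}) ^ Cardinal.aleph0.{u} = Cardinal.aleph 1)
    (hwo : IsWellOrder (H κ) wo) (hκ : κ.IsRegular) {ι : Type v} [Finite ι] {M : ι → ZFSet.{u}}
    (hM : ∀ i, IsSub κ wo (M i)) {h : ZFSet.{u}} (hMh : ∀ i, height (M i) ⊆ h) (k : ℕ)
    (hk : ℵ_ ((k + 1 : ℕ) : Ordinal.{u}) < κ) {N : ZFSet.{u}} (hN : IsModel κ wo k N)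
    {A : ι → ZFSet.{u}} (hAM : ∀ i, A i ∈ M i) (hA : ∀ i, IsCountableSubset (k + 1) (A i))
    (hh : h ∈ height N) {T : Set ZFSet.{u}} (hT : T.Finite) (hTN : ∀ x ∈ T, x ∈ N) :
    ∃ L, (L = N ∨ L ∈ N) ∧ IsSub κ wo L ∧ h ∈ height L ∧ (∀ x ∈ T, x ∈ L) ∧
      ∀ i, A i ∩ L ∈ M i ∧ A i ∩ L ∈ L := by
  have h1 : ℵ_ ((1 : ℕ) : Ordinal.{u}) < κ :=
    (aleph_le_aleph.2 (by exact_mod_cast Nat.le_add_left 1 k)).trans_lt hk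
  have h0 : ℵ₀ < κ := by
    refine lt_of_le_of_lt ?_ h1
    exact aleph0_le_aleph _
  induction k generalizing N A T with
  | zero =>
    have hN' : IsSub κ wo N := hN
    refine ⟨N, .inl rfl, hN', hh, hTN, fun i => ?_⟩
    have hMN : height (M i) ⊆ N := fun x hx =>
      (ZFSet.mem_inter.1 (hN'.subset_of_mem_height hwo hκ h0 hh (hMh i hx))).1
    have hAN := (hM i).mem_of_countable_subset_omega_one CH hN' hwo hκ h1 (hAM i) (hA i) hMN
    rw [ZFSet.inter_eq_left_of_subset (hN'.subset_of_countable hwo hκ h0 hAN (hA i).2)]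
    exact ⟨hAM i, hAN⟩
  | succ k ih =>
    have hk' : ℵ_ ((k + 1 : ℕ) : Ordinal.{u}) < κ :=
      (aleph_le_aleph.2 (by exact_mod_cast Nat.le_succ (k + 1))).trans_lt hk
    have hNs := hN.isSub
    obtain ⟨d, C, hd, hC, hCmem, hCsub, hNC⟩ := hN.exists_chain hwo hκ h0
    have hd0 : 0 < d := by
      obtain ⟨α, hα, -⟩ := (hNC h).1 (ZFSet.mem_inter.1 hh).1
      exact bot_le.trans_lt hα
    obtain ⟨α₀, hα₀, hα₀T⟩ := exists_mem_chain_of_finite hd0 hCsub (hT.insert h) (by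
      rintro x (rfl | hx)
      · exact (hNC x).1 (ZFSet.mem_inter.1 hh).1
      · exact (hNC x).1 (hTN x hx))
    -- Strictly increasing maps `r i` of the `A i` into ordinals below the height of `N` translate
    -- the suprema of the `A i ∩ C α` into functions `g i` of `α` that are bounded below that height.
    choose θ hθ r hrθ hr using fun i => (hM i).exists_rank hwo hκ h1 (hAM i) (hA i)
    have hθd : ∀ i, θ i < d := fun i =>
      (hd _).1 (hNs.subset_of_mem_height hwo hκ h0 hh (hMh i (hθ i)))
    let g : ι → Ordinal.{u} → Ordinal.{u} := fun i α =>
      sInf {b | ∀ a : Ordinal.{u}, a.toZFSet ∈ A i ∩ C α → r i a < b}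
    have hθmem : ∀ i α, θ i ∈ {b | ∀ a : Ordinal.{u}, a.toZFSet ∈ A i ∩ C α → r i a < b} :=
      fun i α a ha => hrθ i a (ZFSet.mem_inter.1 ha).1
    obtain ⟨α, hα, hαd, hstep⟩ :=
      (hNs.isPairingClosed hwo hκ h1 hd).exists_constant_step
        (fun a => hNs.add_one_lt_height hwo hκ hd) g
        (fun i => ⟨θ i + 1, hNs.add_one_lt_height hwo hκ hd (hθd i), fun α _ =>
          Order.lt_add_one_iff.2 (csInf_le' (hθmem i α))⟩)
        (fun i α β hαβ hβ => csInf_le' fun a ha =>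
          csInf_mem (s := {b | ∀ a : Ordinal.{u}, a.toZFSet ∈ A i ∩ C β → r i a < b})
            ⟨_, hθmem i β⟩ a (ZFSet.mem_inter.2
            ⟨(ZFSet.mem_inter.1 ha).1, hCsub α β hαβ hβ (ZFSet.mem_inter.1 ha).2⟩)) hα₀
    have hα1 := hNs.add_one_lt_height hwo hκ hd hαd
    set K := C (α + 1)
    have hKsub : C α ⊆ K := hCsub _ _ le_self_add hα1
    have hCK : C α ∈ K := hCmem _ _ (Order.lt_add_one_iff.2 le_rfl) hα1
    have hKm := (hC _ hα1).2
    have hK := hKm.isSub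
    have hα₀K : ∀ x ∈ insert h T, x ∈ K := fun x hx =>
      hKsub (hCsub _ _ hα hαd (hα₀T x hx))
    have hne : (C α).Nonempty := ⟨h, hCsub _ _ hα hαd (hα₀T h (Set.mem_insert _ _))⟩
    have hξeq : ∀ i, ordSup (A i ∩ C α) = ordSup (A i ∩ K) := fun i =>
      ordSup_inter_eq_of_rank hKsub (hrθ i) (hr i) (hstep i)
    have hξM : ∀ i, (ordSup (A i ∩ K)).toZFSet ∈ M i := fun i =>
      (hM i).ordSup_mem_of_countable hwo hκ h0 hk (hAM i) (hA i) K
    have hξK : ∀ i, (ordSup (A i ∩ K)).toZFSet ∈ K := fun i => by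
      rw [← hξeq]
      exact (hC _ hαd).2.isSub.ordSup_inter_mem_of_mem hK hwo hκ hk hCK hKsub hne (hA i).1
    have hξω : ∀ i, (ordSup (A i ∩ K)).toZFSet ∈ omegaSet.{u} (k + 1 + 1) := fun i =>
      toZFSet_mem_omegaSet.2 ((ordSup_mono fun x hx => (ZFSet.mem_inter.1 hx).1).trans_lt
        (ordSup_lt_omega (hA i)))
    have hωH := omegaSet_mem_H hκ hk'
    -- The common supremum lies in `M i` and in `K`, so `M i` and `K` share an injection of it
    -- into `ω_(k+1)`.
    choose f hf hfM using fun i => exists_canonical_injection (wo := wo) hκ hwo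
      ((hM i).subset _ (hξM i)) hωH
      ((card_le_of_mem_omegaSet_succ (hξω i)).trans_eq (card_omegaSet (k + 1)).symm)
    have hfMi : ∀ i, f i ∈ M i := fun i =>
      hfM i _ (hM i) (hξM i) ((hM i).omegaSet_mem hwo hκ ⟨_, hAM i⟩ hk')
    have hfK : ∀ i, f i ∈ K := fun i =>
      hfM i _ hK (hξK i) (hK.omegaSet_mem hwo hκ ⟨_, hξK i⟩ hk')
    let B : ι → ZFSet.{u} := fun i => (omegaSet (k + 1)).sep fun y =>
      ∃ z ∈ A i ∩ (ordSup (A i ∩ K)).toZFSet, ZFSet.pair z y ∈ f i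
    have hAξ : ∀ i, IsCountableSubset (k + 1 + 1) (A i ∩ (ordSup (A i ∩ K)).toZFSet) := fun i =>
      ⟨fun x hx => (hA i).1 (ZFSet.mem_inter.1 hx).1,
        (hA i).2.mono fun x hx => (ZFSet.mem_inter.1 hx).1⟩
    obtain ⟨L, hLK, hL, hhL, hTL, hBL⟩ := ih hk' hKm (A := B) (T := T ∪ Set.range f)
      (fun i => (hM i).image_mem hwo hωH (hf i) (hfMi i)
        ((hM i).inter_mem hwo (hAM i) (hξM i)))
      (fun i => (hAξ i).image (hf i))
      (ZFSet.mem_inter.2 ⟨hα₀K h (Set.mem_insert _ _), (ZFSet.mem_inter.1 hh).2⟩)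
      (hT.union (Set.finite_range f))
      (by
        rintro x (hx | ⟨i, rfl⟩)
        · exact hα₀K x (Set.mem_insert_of_mem _ hx)
        · exact hfK i)
    have hLsub : L ⊆ K := by
      rcases hLK with rfl | hLK
      · exact subset_rfl
      · exact hK.subset_of_countable hwo hκ h0 hLK hL.countable
    refine ⟨L, .inr ?_, hL, hhL, fun x hx => hTL x (.inl hx), fun i => ?_⟩
    · rcases hLK with rfl | hLK
      · exact (hC _ hα1).1
      · exact (hNC L).2 ⟨_, hα1, hLK⟩
    · have hfL : f i ∈ L := hTL _ (.inr ⟨i, rfl⟩)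
      have hdom : A i ∩ L ⊆ (ordSup (A i ∩ K)).toZFSet := fun x hx => by
        rw [ZFSet.mem_inter] at hx
        obtain ⟨a, -, rfl⟩ := mem_omegaSet.1 ((hA i).1 hx.1)
        exact Ordinal.toZFSet_mem_toZFSet_iff.2
          (lt_ordSup (ZFSet.mem_inter.2 ⟨hx.1, hLsub hx.2⟩))
      have hξH := (hM i).subset _ (hξM i)
      rw [inter_eq_preimage hL hwo (hf i) hfL hdom]
      exact ⟨(hM i).preimage_mem hwo hξH (hf i) (hfMi i) (hBL i).1,
        hL.preimage_mem hwo hξH (hf i) hfL (hBL i).2⟩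

/-! ### Extending decisive partitions -/

theorem inter_subset (A B : ZFSet.{u}) : A ∩ B ⊆ A := fun _ hx => (ZFSet.mem_inter.1 hx).1

theorem sdiff_subset (A B : ZFSet.{u}) : A \ B ⊆ A := fun _ hx => (ZFSet.mem_sdiff.1 hx).1

theorem IsCountableSubset.mono {l : ℕ} {A B : ZFSet.{u}} (hA : IsCountableSubset l A)
    (hBA : B ⊆ A) : IsCountableSubset l B :=
  ⟨fun _ hx => hA.1 (hBA hx), hA.2.mono hBA⟩

/-- `Q` arises from `P` by cutting every member along `L`. -/
def IsCut (L P Q : ZFSet.{u}) : Prop :=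
  ∀ z, z ∈ Q ↔ ∃ A ∈ P, z = A ∩ L ∨ z = A \ L

namespace IsCut

variable {L P Q : ZFSet.{u}}

theorem exists_subset (h : IsCut L P Q) {B : ZFSet.{u}} (hB : B ∈ Q) : ∃ A ∈ P, B ⊆ A := by
  obtain ⟨A, hA, rfl | rfl⟩ := (h B).1 hB
  · exact ⟨A, hA, inter_subset A L⟩
  · exact ⟨A, hA, sdiff_subset A L⟩

theorem finite (h : IsCut L P Q) (hP : (P : Set ZFSet.{u}).Finite) : (Q : Set ZFSet.{u}).Finite :=
  ((hP.image fun A => A ∩ L).union (hP.image fun A => A \ L)).subset fun z hz => by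
    obtain ⟨A, hA, rfl | rfl⟩ := (h z).1 hz
    · exact .inl ⟨A, hA, rfl⟩
    · exact .inr ⟨A, hA, rfl⟩

theorem isPartition (h : IsCut L P Q) (hP : IsPartition P) : IsPartition Q := by
  intro A' hA' B' hB' hne
  refine (ZFSet.eq_empty _).2 fun x hx => hne ?_
  rw [ZFSet.mem_inter] at hx
  have hAB : ∀ A ∈ P, ∀ B ∈ P, x ∈ A → x ∈ B → A = B := fun A hA B hB hxA hxB => by
    by_contra h
    exact ZFSet.notMem_empty x (hP A hA B hB h ▸ ZFSet.mem_inter.2 ⟨hxA, hxB⟩)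
  obtain ⟨A, hA, rfl | rfl⟩ := (h A').1 hA' <;> obtain ⟨B, hB, rfl | rfl⟩ := (h B').1 hB' <;>
    simp only [ZFSet.mem_inter, ZFSet.mem_sdiff] at hx
  · rw [hAB A hA B hB hx.1.1 hx.2.1]
  · exact absurd hx.1.2 hx.2.2
  · exact absurd hx.2.2 hx.1.2
  · rw [hAB A hA B hB hx.1.1 hx.2.1]

theorem refines (h : IsCut L P Q) : Refines Q P := by
  refine ⟨fun B hB => h.exists_subset hB, fun B hB => ⟨{B ∩ L, B \ L}, ?_, ?_⟩⟩
  · intro z hz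
    exact (h z).2 ⟨B, hB, ZFSet.mem_pair.1 hz⟩
  · ext x
    rw [ZFSet.sUnion_pair, ZFSet.mem_union, ZFSet.mem_inter, ZFSet.mem_sdiff]
    tauto

end IsCut

theorem IsSub.exists_isCut {M : ZFSet.{u}} (hM : IsSub κ wo M) (hwo : IsWellOrder (H κ) wo)
    (hκ : κ.IsRegular) (h0 : ℵ₀ < κ) {P L : ZFSet.{u}} (hPM : P ∈ M)
    (hP : (P : Set ZFSet.{u}).Finite) (hL : ∀ A ∈ P, A ∩ L ∈ M) : ∃ Q ∈ M, IsCut L P Q := by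
  have hsub := hM.subset_of_countable hwo hκ h0 hPM hP.countable
  obtain ⟨Q, hQM, hQ⟩ := hM.mem_of_finite hwo hκ ⟨_, hPM⟩
    ((hP.image fun A => A ∩ L).union (hP.image fun A => A \ L)) (by
      rintro x (⟨A, hA, rfl⟩ | ⟨A, hA, rfl⟩)
      · exact hL A hA
      · have h : A \ (A ∩ L) = A \ L := by
          ext x
          simp only [ZFSet.mem_sdiff, ZFSet.mem_inter]
          tauto
        change A \ L ∈ M
        rw [← h]
        exact hM.sdiff_mem hwo (hsub hA) (hL A hA))
  refine ⟨Q, hQM, fun z => (hQ z).trans ?_⟩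
  constructor
  · rintro (⟨A, hA, rfl⟩ | ⟨A, hA, rfl⟩)
    · exact ⟨A, hA, .inl rfl⟩
    · exact ⟨A, hA, .inr rfl⟩
  · rintro ⟨A, hA, rfl | rfl⟩
    · exact .inl ⟨A, hA, rfl⟩
    · exact .inr ⟨A, hA, rfl⟩

/-- Members of different `P i` and `P j` that share a point coincide: by decisiveness the earlier
one belongs to the later partition or misses the later model, which contains the other set. -/
theorem IsDecisive.eq_of_mem_of_mem {l m : ℕ} {M P : Fin m → ZFSet.{u}} (hP : IsDecisive l M P)
    (hPM : ∀ i, ∀ A ∈ P i, A ⊆ M i) {i j : Fin m} {A B x : ZFSet.{u}} (hA : A ∈ P i) (hB : B ∈ P j)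
    (hxA : x ∈ A) (hxB : x ∈ B) : A = B := by
  wlog hij : i ≤ j generalizing i j A B
  · exact (this hB hA hxB hxA (le_of_not_ge hij)).symm
  have hAj : A ∈ P j := by
    rcases hij.eq_or_lt with rfl | hlt
    · exact hA
    · refine (hP.decisive i j hlt A hA).resolve_right fun hAM => ?_
      exact ZFSet.notMem_empty x (hAM ▸ ZFSet.mem_inter.2 ⟨hxA, hPM j B hB hxB⟩)
  by_contra hne
  exact ZFSet.notMem_empty x (hP.partition j A hAj B hB hne ▸ ZFSet.mem_inter.2 ⟨hxA, hxB⟩)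

/-- If all traces `A ∩ L` with `A ∈ P i` belong to `M i` and to `L`, then `P` can be refined and
extended to a decisive partition for `M` followed by `L`. -/
theorem IsDecisive.exists_extension (hwo : IsWellOrder (H κ) wo) (hκ : κ.IsRegular) (h0 : ℵ₀ < κ)
    {l m : ℕ} {M P : Fin m → ZFSet.{u}} (hP : IsDecisive l M P) (hM : ∀ i, IsSub κ wo (M i))
    {L D : ZFSet.{u}} (hL : IsSub κ wo L) (hDL : D ∈ L) (hD : IsCountableSubset l D)
    (hPL : ∀ i, ∀ A ∈ P i, A ∩ L ∈ M i ∧ A ∩ L ∈ L) :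
    ∃ R : Fin (m + 1) → ZFSet.{u}, IsDecisive l (Fin.snoc (α := fun _ => ZFSet.{u}) M L) R ∧
      (∀ i : Fin m, Refines (R i.castSucc) (P i)) ∧ D ⊆ ⋃₀ R (Fin.last m) := by
  have hPM : ∀ i, ∀ A ∈ P i, A ⊆ M i := fun i A hA =>
    (hM i).subset_of_countable hwo hκ h0 ((hM i).subset_of_countable hwo hκ h0 (hP.mem i)
      (hP.finite i).countable hA) (hP.countable i A hA).2
  choose Q hQM hQ using fun i => (hM i).exists_isCut hwo hκ h0 (hP.mem i) (hP.finite i)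
    fun A hA => (hPL i A hA).1
  -- The new partition consists of the traces on `L` and of the part of `D` not covered by them.
  have htr : (⋃ i, (fun A => A ∩ L) '' (P i : Set ZFSet.{u})).Finite :=
    Set.finite_iUnion fun i => (hP.finite i).image _
  obtain ⟨S, hSL, hS⟩ := hL.mem_of_finite hwo hκ ⟨D, hDL⟩ htr (by
    intro x hx
    obtain ⟨i, A, hA, rfl⟩ := Set.mem_iUnion.1 hx
    exact (hPL i A hA).2)
  have hSfin : (S : Set ZFSet.{u}).Finite := htr.subset fun z hz => (hS z).1 hz
  replace hS : ∀ z, z ∈ S ↔ ∃ i, ∃ A ∈ P i, z = A ∩ L := fun z => by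
    rw [hS, Set.mem_iUnion]
    refine exists_congr fun i => ⟨?_, ?_⟩
    · rintro ⟨A, hA, rfl⟩; exact ⟨A, hA, rfl⟩
    · rintro ⟨A, hA, rfl⟩; exact ⟨A, hA, rfl⟩
  let E := D \ ⋃₀ S
  have hlast : ∀ z, z ∈ insert E S ↔ z = E ∨ z ∈ S := fun z => ZFSet.mem_insert_iff
  have hrest : ∀ A ∈ S, ∀ x ∈ A, x ∉ E := fun A hA x hxA hxE =>
    (ZFSet.mem_sdiff.1 hxE).2 (ZFSet.mem_sUnion.2 ⟨A, hA, hxA⟩)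
  have hpart : IsPartition (insert E S) := by
    intro A' hA' B' hB' hne
    refine (ZFSet.eq_empty _).2 fun x hx => ?_
    rw [ZFSet.mem_inter] at hx
    rcases (hlast A').1 hA' with rfl | hA' <;> rcases (hlast B').1 hB' with rfl | hB'
    · exact hne rfl
    · exact hrest B' hB' x hx.2 hx.1
    · exact hrest A' hA' x hx.1 hx.2
    · obtain ⟨i, A, hA, rfl⟩ := (hS A').1 hA'
      obtain ⟨j, B, hB, rfl⟩ := (hS B').1 hB'
      rw [hP.eq_of_mem_of_mem hPM hA hB (inter_subset _ _ hx.1) (inter_subset _ _ hx.2)] at hne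
      exact hne rfl
  have hcount : ∀ A ∈ insert E S, IsCountableSubset l A := by
    intro A' hA'
    rcases (hlast A').1 hA' with rfl | hA'
    · exact hD.mono (sdiff_subset _ _)
    · obtain ⟨i, A, hA, rfl⟩ := (hS A').1 hA'
      exact (hP.countable i A hA).mono (inter_subset _ _)
  refine ⟨Fin.snoc (α := fun _ => ZFSet.{u}) Q (insert E S), ⟨?_, ?_, ?_, ?_, ?_⟩, ?_, ?_⟩
  · refine Fin.lastCases ?_ fun i => ?_
    · simp only [Fin.snoc_last]
      exact hL.insert_mem hwo hκ (hL.sdiff_sUnion_mem hwo hDL hSL) hSL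
    · simpa only [Fin.snoc_castSucc] using hQM i
  · refine Fin.lastCases ?_ fun i => ?_
    · simp only [Fin.snoc_last]
      rw [ZFSet.coe_insert]
      exact hSfin.insert E
    · simpa only [Fin.snoc_castSucc] using (hQ i).finite (hP.finite i)
  · refine Fin.lastCases ?_ fun i => ?_
    · simpa only [Fin.snoc_last] using hpart
    · simpa only [Fin.snoc_castSucc] using (hQ i).isPartition (hP.partition i)
  · refine Fin.lastCases ?_ fun i => ?_
    · simpa only [Fin.snoc_last] using hcount
    · simp only [Fin.snoc_castSucc]
      intro B hB
      obtain ⟨A, hA, hBA⟩ := (hQ i).exists_subset hB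
      exact (hP.countable i A hA).mono hBA
  · intro i j
    refine Fin.lastCases ?_ (fun j => ?_) j
    · refine Fin.lastCases (fun hlt => absurd hlt (lt_irrefl _)) (fun i _ => ?_) i
      simp only [Fin.snoc_last, Fin.snoc_castSucc]
      intro A' hA'
      obtain ⟨A, hA, rfl | rfl⟩ := (hQ i A').1 hA'
      · exact .inl ((hlast _).2 (.inr ((hS _).2 ⟨i, A, hA, rfl⟩)))
      · refine .inr ((ZFSet.eq_empty _).2 fun x hx => ?_)
        rw [ZFSet.mem_inter, ZFSet.mem_sdiff] at hx
        exact hx.1.2 hx.2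
    · refine Fin.lastCases (fun hlt => absurd hlt (Fin.le_last _).not_gt) (fun i hlt => ?_) i
      simp only [Fin.snoc_castSucc]
      intro A' hA'
      obtain ⟨A, hA, hAA⟩ := (hQ i A').1 hA'
      have hsub : A' ⊆ A := by
        rcases hAA with rfl | rfl
        · exact inter_subset _ _
        · exact sdiff_subset _ _
      rcases hP.decisive i j (Fin.castSucc_lt_castSucc_iff.1 hlt) A hA with hAj | hAj
      · exact .inl ((hQ j A').2 ⟨A, hAj, hAA⟩)
      · refine .inr ((ZFSet.eq_empty _).2 fun x hx => ?_)
        rw [ZFSet.mem_inter] at hx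
        exact ZFSet.notMem_empty x (hAj ▸ ZFSet.mem_inter.2 ⟨hsub hx.1, hx.2⟩)
  · intro i
    simpa only [Fin.snoc_castSucc] using (hQ i).refines
  · simp only [Fin.snoc_last]
    intro x hx
    rw [ZFSet.mem_sUnion]
    by_cases hxS : x ∈ ⋃₀ S
    · obtain ⟨A, hA, hxA⟩ := ZFSet.mem_sUnion.1 hxS
      exact ⟨A, (hlast A).2 (.inr hA), hxA⟩
    · exact ⟨E, (hlast E).2 (.inl rfl), ZFSet.mem_sdiff.2 ⟨hx, hxS⟩⟩

end CountableModels

theorem mainTheorem5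
    (CH : (2 : Cardinal.{u}) ^ Cardinal.aleph0.{u} = Cardinal.aleph 1)
    (l : ℕ) (hl : 0 < l)
    (κ : Cardinal.{u}) (hκ : κ.IsRegular) (hlκ : Cardinal.aleph (l : Ordinal.{u}) < κ)
    (wo : CountableModels.H κ → CountableModels.H κ → Prop)
    (hwo : IsWellOrder (CountableModels.H κ) wo)
    (n : ℕ) (M P : Fin (n + 1) → ZFSet.{u})
    (hM : CountableModels.IsDeltaIncreasing κ wo M)
    (hP : CountableModels.IsDecisive l M P)
    (N : ZFSet.{u}) (hN : CountableModels.IsModel κ wo l N)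
    (hMN : CountableModels.height (M (Fin.last n)) ∈ CountableModels.height N)
    (D X : ZFSet.{u}) (hDN : D ∈ N) (hD : CountableModels.IsCountableSubset l D) (hX : X ∈ N) :
    ∃ L ∈ N, ∃ R : Fin (n + 2) → ZFSet.{u},
      (CountableModels.IsSub κ wo L ∧
        CountableModels.height (M (Fin.last n)) ∈ CountableModels.height L ∧ X ∈ L ∧ D ∈ L) ∧
      CountableModels.IsDecisive l (Fin.snoc (α := fun _ => ZFSet.{u}) M L) R ∧
      (∀ i : Fin (n + 1), CountableModels.Refines (R i.castSucc) (P i)) ∧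
      D ⊆ ZFSet.sUnion (R (Fin.last (n + 1))) := by
  obtain ⟨hMs, hMδ⟩ := hM
  have h0 : Cardinal.aleph0 < κ := (Cardinal.aleph0_le_aleph _).trans_lt hlκ
  obtain ⟨k, rfl⟩ : ∃ k, l = k + 1 := ⟨l - 1, by omega⟩
  set h := CountableModels.height (M (Fin.last n))
  obtain ⟨d, C, hd, hC, hCmem, hCsub, hNC⟩ := hN.exists_chain hwo hκ h0
  have hd0 : 0 < d := by
    obtain ⟨α, hα, -⟩ := (hNC X).1 hX
    exact bot_le.trans_lt hα
  obtain ⟨α, hα, hαT⟩ := CountableModels.exists_mem_chain_of_finite hd0 hCsub (T := {h, X, D})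
    (by simp) (by
      rintro x (rfl | rfl | rfl)
      · exact (hNC _).1 (ZFSet.mem_inter.1 hMN).1
      · exact (hNC _).1 hX
      · exact (hNC _).1 hDN)
  let ι := Σ i : Fin (n + 1), (P i : Set ZFSet.{u})
  have : ∀ i, Finite (P i : Set ZFSet.{u}) := fun i => (hP.finite i).to_subtype
  have : Finite ι := inferInstance
  obtain ⟨L, hLC, hL, hhL, hTL, hAL⟩ := CountableModels.exists_model_inter_mem CH hwo hκ (ι := ι)
    (M := fun p => M p.1) (fun p => hMs p.1) (h := h) (fun p => hMδ _ _ (Fin.le_last _)) k hlκ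
    (hC α hα).2 (A := fun p => p.2.1)
    (fun p => (hMs p.1).subset_of_countable hwo hκ h0 (hP.mem p.1) (hP.finite p.1).countable p.2.2)
    (fun p => hP.countable p.1 _ p.2.2)
    (ZFSet.mem_inter.2 ⟨hαT h (by simp), (ZFSet.mem_inter.1 hMN).2⟩)
    (T := {X, D}) (by simp)
    (by
      rintro x (rfl | rfl)
      · exact hαT _ (by simp)
      · exact hαT _ (by simp))
  have hXL : X ∈ L := hTL X (by simp)
  have hDL : D ∈ L := hTL D (by simp)
  have hLN : L ∈ N := by
    rcases hLC with rfl | hLC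
    · exact (hC α hα).1
    · exact (hNC L).2 ⟨α, hα, hLC⟩
  obtain ⟨R, hR, hRP, hDR⟩ := hP.exists_extension hwo hκ h0 hMs hL hDL hD
    fun i A hA => hAL ⟨i, A, hA⟩
  exact ⟨L, hLN, R, ⟨hL, hhL, hXL, hDL⟩, hR, hRP, hDR⟩
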